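/- **Setting.** An Ex-BMDP has a finite set $\mathcal S$ of endogenous states, a finite set $\mathcal A$ of actions, an observation space $\mathcal X$ and an exogenous state space $\mathcal E$. The endogenous state evolves deterministically, $s_{t+1}=T(s_t,a_t)$, from an arbitrary $s_{\rm init}\in\mathcal S$; the exogenous state is a Markov chain $e_{t+1}\sim\mathcal T_e(e_t)$, $e_0\sim\pi^{\rm init}_{\mathcal E}$, independent of the actions; and $x_t\sim\mathcal Q(s_t,e_t)$. Every emission of $\mathcal Q(s,e)$ satisfies $\phi^*(x)=s$. Any two states of $\mathcal S$ are reachable from one another in at most $D$ steps. The chain $\mathcal T_e$ has a stationary law $\pi_{\mathcal E}$ and mixing time $t_{\rm mix}(1/4)\le\hat t_{\rm mix}$ (total variation, uniformly over initial states). Known to the algorithm: $N\ge|\mathcal S|$ with $N\ge2$, $\hat D\ge D$, $\hat t_{\rm mix}\ge1$, $\delta\in(0,1]$, a finite class $\mathcal F$ of functions $\mathcal X\to\{0,1\}$ that contains $x\mapsto\mathbb 1[\phi^*(x)=s]$ for each $s\in\mathcal S$, and a training oracle which, given finite multisets $D_0,D_1$ of observations, returns a member of $\mathcal F$, and one that *separates*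 them ($0$ on all of $D_0$, $1$ on all of $D_1$) whenever $\mathcal F$ contains such a member. "The oracle separates $D_0,D_1$" means that the returned function does. Put $$n_{\rm sc}=\Big\lceil \ln\tfrac{\delta}{4|\mathcal A|N(N-1)|\mathcal F|}\big/\ln\tfrac9{16}\Big\rceil,\qquad n_{\rm samp}=\Big\lceil \ln\tfrac{\delta}{4|\mathcal A|N^4(\hat D+1)|\mathcal F|}\big/\ln\tfrac9{16}\Big\rceil .$$ **CycleFind.** Input: a non-empty action sequence $\hat a=(\hat a_0,\dots,\hat a_{\ell-1})$, a finite set $\mathcal S'$ of learned states, a partial transition function $T':\mathcal S'\times\mathcal A\to\mathcal S'\cup\{\bot\}$, and a dataset $\mathcal D(s)$ of earlier observations for each $s\in\mathcal S'$. CycleFind takes the actions of $\hat a$ in a loop; $x_j$ denotes the observation after its $j$-th action. 1. Let $b=\max((N-1)\ell,\hat t_{\rm mix})$ and $c_{\rm init}=(2\hat t_{\rm mix}+3N\ell-2)n_{\rm sc}-\hat t_{\rm mix}-N\ell+1+b$. Take $c_{\rm init}$ actions; write $\bar x_i=x_{i\ell+b}$. For $n'=N,N-1,\dots,2$ let $r=\lceil\hat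 t_{\rm mix}/(n'\ell)\rceil n'$, $k=\big\lfloor (c_{\rm init}+r\ell-b)/(2r\ell+n'\ell)\big\rfloor$, $D_0=\{\bar x_{r+(2r+n')i+j}:0\le i<k,\,1\le j<n'\}$, $D_1=\{\bar x_{(2r+n')i}:0\le i<k\}$; the first $n'$ for which the oracle separates $D_0,D_1$ is taken as $n$. If there is none, $n=1$. 2. Let $L=\ell n$, $R=L\lceil\hat t_{\rm mix}/L\rceil$, $n_0=\max((N-n)\ell,\hat t_{\rm mix})$, $n_0'=n_0+(n_{\rm samp}-1)R+L+\hat t_{\rm mix}$ and $c=2L\big((n_{\rm samp}-1)\lceil\hat t_{\rm mix}/L\rceil+1\big)+\hat t_{\rm mix}+n_0$. Take further actions until $\max(c_{\rm init},c)$ have been taken. For $0\le i<L$ let $\mathcal D_i'$ consist of all $x_j$ with $j=kR+o+((i-o)\bmod L)$, $0\le k<n_{\rm samp}$, $o\in\{n_0,n_0'\}$. 3. For $i=0,\dots,L-1$: if there is $s\in\mathcal S'$ such that the oracle does not separate $\mathcal D(s),\mathcal D_i'$, let $s_i^{\rm cyc}$ be the first such $s$; optionally $\mathcal D_i'$ is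 then merged into $\mathcal D(s)$, provided that the samples of the merged dataset are still pairwise at least $\hat t_{\rm mix}$ steps apart. Otherwise add a new state $s_i^{\rm cyc}$ to $\mathcal S'$ with dataset $\mathcal D_i'$ and all transitions $\bot$. 4. For $0\le i<L$ set $T'(s_i^{\rm cyc},\hat a_{i\bmod\ell})\leftarrow s^{\rm cyc}_{(i+1)\bmod L}$. Return $\mathcal S',\mathcal D,T'$ and $s_{\rm curr}=s^{\rm cyc}_{\max(c,c_{\rm init})\bmod L}$. **Inductive assumptions** on $(\mathcal S',T',\mathcal D)$ at a given time: there is an injective $\sigma^{-1}:\mathcal S'\to\mathcal S$ such that for all $s\in\mathcal S'$ and $a\in\mathcal A$, $T'(s,a)=\bot$ or $\sigma^{-1}(T'(s,a))=T(\sigma^{-1}(s),a)$, and $\phi^*(x)=\sigma^{-1}(s)$ for all $x\in\mathcal D(s)$; and for each $s\in\mathcal S'$, $\mathcal D(s)$ consists of at least $n_{\rm samp}$ observations of the trajectory so far, at times that are pairwise at least $\hat t_{\rm mix}$ apart. Moreover $\mathcal S'$, $T'$ and the sample times of all $\mathcal D(s)$ are deterministic, i.e. independent of the noise (exogenous dynamics,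 emissions, initial exogenous state). **Proposition.** (a) For every non-empty action sequence $\hat a$ of length $\ell\le(D+1)N$ there are $1\le n_{\rm cyc}\le N$ and states $s_0^*,\dots,s^*_{\ell n_{\rm cyc}-1}\in\mathcal S$ such that $T(s_i^*,\hat a_{i\bmod\ell})=s^*_{(i+1)\bmod \ell n_{\rm cyc}}$ for all $0\le i<\ell n_{\rm cyc}$. (b) Suppose that finitely many actions, fixed independently of the noise, have been taken from $s_{\rm init}$, that $(\mathcal S',T',\mathcal D)$ satisfies the inductive assumptions, and that a non-empty $\hat a$ of length $\ell\le(D+1)N$ is likewise fixed independently of the noise. Then there is a deterministic output (updated $\mathcal S'_{\rm new},T'_{\rm new}$, sample times of $\mathcal D_{\rm new}$, $s_{\rm curr}$ and number of actions), not depending on the noise, such that with probability at least $1-\frac{\delta}{2|\mathcal A|N}$ CycleFind returns exactly this output, and the following hold: - $(\mathcal S'_{\rm new},T'_{\rm new},\mathcal D_{\rm new})$ satisfies the inductive assumptions at the final time, through an injective map that extends $\sigma^{-1}$ (also denoted $\sigma^{-1}$); in particular $\mathcal S'\subseteq\mathcal S'_{\rm new}$; - for some cycle $s_0^*,\dots,s^*_{\ell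 n_{\rm cyc}-1}$ as in (a), with $n_{\rm cyc}\le N$, all $s_i^*$ lie in $\sigma^{-1}(\mathcal S'_{\rm new})$; - $T'_{\rm new}$ extends $T'$ and contains the transitions of this cycle: for every $i$ there are $s,s'\in\mathcal S'_{\rm new}$ with $\sigma^{-1}(s)=s_i^*$, $\sigma^{-1}(s')=s^*_{(i+1)\bmod \ell n_{\rm cyc}}$ and $T'_{\rm new}(s,\hat a_{i\bmod\ell})=s'$; - $s_{\rm curr}\in\mathcal S'_{\rm new}$, and the final observation $x$ satisfies $\sigma^{-1}(s_{\rm curr})=\phi^*(x)$; - the number of actions taken by CycleFind is at most $$\max\Big((2\hat t_{\rm mix}+3N\ell-2)\,n_{\rm sc}-N\ell,\;2(\hat t_{\rm mix}+|\mathcal S|\ell-1)\,n_{\rm samp}+1\Big)+\max(N\ell-\ell-\hat t_{\rm mix},0)+1 .$$ -/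

import Mathlib

open MeasureTheory ProbabilityTheory

namespace STEEL

/-! ### Exogenous noise -/

section Noise

variable {E X S : Type*} [MeasurableSpace E] [MeasurableSpace X]

/-- Total variation distance (of probability measures): `sup_B |μ(B) - ν(B)|`. -/
noncomputable def tvDist (μ ν : Measure E) : ℝ :=
  ⨆ B : {B : Set E // MeasurableSet B}, |μ.real B.1 - ν.real B.1|

/-- The mixing time `t_mix(ε)` of the chain `K` with stationary law `π`: the least `t` such that
`‖K^t(e, ·) - π‖_TV ≤ ε` for every initial state `e` (and `⊤` if there is no such `t`). -/
noncomputable def mixingTime (K : Kernel E E) (π : Measure E) (ε : ℝ) : ℕ∞ :=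
  sInf ((fun t : ℕ => (t : ℕ∞)) '' {t : ℕ | ∀ e, tvDist ((K ^ t) e) π ≤ ε})

/-- One joint step: `e' ∼ Te(e)`, then `x' ∼ Q(s', e')`; the result is the pair `(e', x')`. -/
noncomputable def stepKernel (Q : S → Kernel E X) (Te : Kernel E E) (s' : S) :
    Kernel E (E × X) :=
  (Kernel.id ×ₖ Q s') ∘ₖ Te

instance (Q : S → Kernel E X) (Te : Kernel E E) [∀ s, IsMarkovKernel (Q s)] [IsMarkovKernel Te]
    (s' : S) : IsMarkovKernel (stepKernel Q Te s') := by
  unfold stepKernel; infer_instance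

/-- The step kernel as a function of the whole history (of which it reads only the last exogenous
state). -/
noncomputable def histKernel (Q : S → Kernel E X) (Te : Kernel E E) (lat : ℕ → S) (n : ℕ) :
    Kernel ((i : Finset.Iic n) → (fun _ : ℕ => E × X) i) (E × X) :=
  (stepKernel Q Te (lat (n + 1))).comap (fun h => (h ⟨n, by simp⟩).1) (by fun_prop)

instance (Q : S → Kernel E X) (Te : Kernel E E) [∀ s, IsMarkovKernel (Q s)] [IsMarkovKernel Te]
    (lat : ℕ → S) (n : ℕ) : IsMarkovKernel (histKernel Q Te lat n) := by
  unfold histKernel; infer_instance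

/-- The law of the trajectory `t ↦ (e_t, x_t)` when the endogenous states are
`lat 0, lat 1, …`: `e_0 ∼ init`, `e_{t+1} ∼ Te(e_t)`, `x_t ∼ Q(lat t, e_t)`. -/
noncomputable def trajLaw (Q : S → Kernel E X) (Te : Kernel E E) [∀ s, IsMarkovKernel (Q s)]
    [IsMarkovKernel Te] (init : Measure E) (lat : ℕ → S) : Measure (ℕ → E × X) :=
  Kernel.trajMeasure (X := fun _ => E × X) (init.bind (Kernel.id ×ₖ Q (lat 0)))
    (histKernel Q Te lat)

end Noise

/-! ### Endogenous dynamics -/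

section Latent

variable {S A : Type*} {ℓ : ℕ} [NeZero ℓ]

/-- The actions taken on the system: first the fixed list `past`, then `â` in a loop.
Here `Fin.ofNat ℓ i` is `i % ℓ`. -/
def actionSeq (past : List A) (â : Fin ℓ → A) (t : ℕ) : A :=
  if h : t < past.length then past[t] else â (Fin.ofNat ℓ (t - past.length))

/-- The endogenous states `s_0 = s`, `s_{t+1} = T(s_t, α_t)`. -/
def latentSeq (T : S → A → S) (s : S) (α : ℕ → A) : ℕ → S
  | 0 => s
  | t + 1 => T (latentSeq T s α t) (α t)

/-- Every state can be reached from every state in at most `D` steps. -/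
def ReachableWithin (T : S → A → S) (D : ℕ) : Prop :=
  ∀ s s' : S, ∃ l : List A, l.length ≤ D ∧ l.foldl T s = s'

/-- `cyc 0, …, cyc (ℓ n - 1)` is a closed cycle of states traversed by looping `â`. -/
def IsLatentCycle (T : S → A → S) (â : Fin ℓ → A) (n : ℕ) (cyc : ℕ → S) : Prop :=
  0 < n ∧ ∀ i < ℓ * n, T (cyc i) (â (Fin.ofNat ℓ i)) = cyc ((i + 1) % (ℓ * n))

end Latent

/-! ### Training oracles -/

section Oracle

variable {X : Type*}

/-- `f` is `0` on all of `D₀` and `1` on all of `D₁`. -/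
def Separates (f : X → Bool) (D₀ D₁ : Multiset X) : Prop :=
  (∀ x ∈ D₀, f x = false) ∧ ∀ x ∈ D₁, f x = true

instance (f : X → Bool) (D₀ D₁ : Multiset X) : Decidable (Separates f D₀ D₁) :=
  inferInstanceAs (Decidable (_ ∧ _))

/-- A training oracle for `F` returns a member of `F`, and one that separates the two multisets
whenever `F` contains such a member. -/
def IsTrainingOracle (F : Finset (X → Bool)) (O : Multiset X → Multiset X → X → Bool) : Prop :=
  ∀ D₀ D₁, O D₀ D₁ ∈ F ∧ ((∃ f ∈ F, Separates f D₀ D₁) → Separates (O D₀ D₁) D₀ D₁)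

end Oracle

/-! ### The subroutine CycleFind -/

/-- The partial model. Learned states are labelled by natural numbers and listed in the order in
which they are looped over; `none` is the undefined value `⊥`. A dataset is stored as the set of the
times at which its samples were collected; the multiset of observations is `sample x (data s)`. -/
structure PartialModel (A : Type*) where
  states : List ℕ
  trans : ℕ → A → Option ℕ
  data : ℕ → Finset ℕ

/-- What is known to the algorithm. `merge i s` says whether the optional merging of the new dataset
number `i` into the dataset of the old state `s` is wanted. -/
structure Params (X : Type*) where
  N : ℕ
  Dhat : ℕ
  tmix : ℕ
  δ : ℝ
  F : Finset (X → Bool)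
  oracle : Multiset X → Multiset X → X → Bool
  merge : ℕ → ℕ → Bool

/-- The returned partial model, the returned current state `s_curr`, and the number of actions
taken. -/
structure Output (A : Type*) where
  model : PartialModel A
  curr : ℕ
  steps : ℕ

/-- Any two distinct times in `τ` differ by at least `t`. -/
def Spaced (t : ℕ) (τ : Finset ℕ) : Prop := ∀ i ∈ τ, ∀ j ∈ τ, i < j → i + t ≤ j

instance (t : ℕ) (τ : Finset ℕ) : Decidable (Spaced t τ) := by
  unfold Spaced; infer_instance

/-- The multiset of the observations made at the times in `τ`. -/
def sample {X : Type*} (x : ℕ → X) (τ : Finset ℕ) : Multiset X := τ.val.map x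

/-- The number `n_samp` of samples. -/
noncomputable def nSamp {X : Type*} (P : Params X) (A : Type*) [Fintype A] : ℕ :=
  ⌈Real.log (P.δ / (4 * Fintype.card A * (P.N : ℝ) ^ 4 * (P.Dhat + 1) * P.F.card)) /
    Real.log (9 / 16)⌉₊

/-- The number `n_samp.cyc.` of samples. -/
noncomputable def nSampCyc {X : Type*} (P : Params X) (A : Type*) [Fintype A] : ℕ :=
  ⌈Real.log (P.δ / (4 * Fintype.card A * (P.N : ℝ) * ((P.N : ℝ) - 1) * P.F.card)) /
    Real.log (9 / 16)⌉₊

section CycleFind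

variable {X A : Type*} [Fintype A]

/-- The number of initial transitions that are skipped. -/
def skip (P : Params X) (ℓ : ℕ) : ℕ := max ((P.N - 1) * ℓ) P.tmix

/-- The number `c_init` of actions of the first phase (no subtraction truncates, as `2 ≤ N`,
`1 ≤ ℓ` and `1 ≤ n_samp.cyc.`). -/
noncomputable def cInit (P : Params X) (A : Type*) [Fintype A] (ℓ : ℕ) : ℕ :=
  (2 * P.tmix + 3 * P.N * ℓ - 2) * nSampCyc P A - P.tmix - P.N * ℓ + 1 + skip P ℓ

/-- The time at which `x̄_i` is observed, if the subroutine starts at time `t₀`. -/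
def barTime (P : Params X) (ℓ t₀ i : ℕ) : ℕ := t₀ + (i * ℓ + skip P ℓ)

/-- The gap `r` used to test the candidate `n'`. -/
def gap (P : Params X) (ℓ n' : ℕ) : ℕ := P.tmix ⌈/⌉ (n' * ℓ) * n'

/-- The number `k` of blocks used to test the candidate `n'`. -/
noncomputable def blocks (P : Params X) (A : Type*) [Fintype A] (ℓ n' : ℕ) : ℕ :=
  (cInit P A ℓ + gap P ℓ n' * ℓ - skip P ℓ) / (2 * gap P ℓ n' * ℓ + n' * ℓ)

/-- The times of the samples in `D₀`, for the candidate `n'`. -/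
noncomputable def times₀ (P : Params X) (A : Type*) [Fintype A] (ℓ t₀ n' : ℕ) : Finset ℕ :=
  (Finset.range (blocks P A ℓ n') ×ˢ Finset.Icc 1 (n' - 1)).image fun p =>
    barTime P ℓ t₀ (gap P ℓ n' + (2 * gap P ℓ n' + n') * p.1 + p.2)

/-- The times of the samples in `D₁`, for the candidate `n'`. -/
noncomputable def times₁ (P : Params X) (A : Type*) [Fintype A] (ℓ t₀ n' : ℕ) : Finset ℕ :=
  (Finset.range (blocks P A ℓ n')).image fun i => barTime P ℓ t₀ ((2 * gap P ℓ n' + n') * i)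

/-- Does the classifier returned by the oracle separate the observations at the times `τ₀` from
those at the times `τ₁`? -/
def test (P : Params X) (x : ℕ → X) (τ₀ τ₁ : Finset ℕ) : Bool :=
  decide (Separates (P.oracle (sample x τ₀) (sample x τ₁)) (sample x τ₀) (sample x τ₁))

/-- The loop over the candidates `n', n' - 1, …, 2`; the default value is `1`. -/
noncomputable def findPeriod (P : Params X) (A : Type*) [Fintype A] (ℓ t₀ : ℕ) (x : ℕ → X) :
    ℕ → ℕ
  | 0 => 1
  | 1 => 1
  | n + 2 =>
    if test P x (times₀ P A ℓ t₀ (n + 2)) (times₁ P A ℓ t₀ (n + 2)) then n + 2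
    else findPeriod P A ℓ t₀ x (n + 1)

/-- The number `c` of actions needed by the second phase, with period `n * ℓ`. -/
noncomputable def cFull (P : Params X) (A : Type*) [Fintype A] (ℓ n : ℕ) : ℕ :=
  2 * n * ℓ * ((nSamp P A - 1) * (P.tmix ⌈/⌉ (ℓ * n)) + 1) + P.tmix +
    max ((P.N - n) * ℓ) P.tmix

/-- The offset `n₀`. -/
def offA (P : Params X) (ℓ n : ℕ) : ℕ := max ((P.N - n) * ℓ) P.tmix

/-- The offset `n₀'`. -/
noncomputable def offB (P : Params X) (A : Type*) [Fintype A] (ℓ n : ℕ) : ℕ :=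
  offA P ℓ n + (nSamp P A - 1) * (ℓ * n * (P.tmix ⌈/⌉ (ℓ * n))) + ℓ * n + P.tmix

/-- The times of the samples in the dataset `D'_i`. The remainder is that of integers, in
`{0, …, ℓ n - 1}`. -/
noncomputable def newTimes (P : Params X) (A : Type*) [Fintype A] (ℓ t₀ n i : ℕ) : Finset ℕ :=
  (Finset.range (nSamp P A) ×ˢ {offA P ℓ n, offB P A ℓ n}).image fun p =>
    t₀ + (p.1 * (ℓ * n * (P.tmix ⌈/⌉ (ℓ * n))) + p.2 +
      (((i : ℤ) - (p.2 : ℤ)) % ((ℓ * n : ℕ) : ℤ)).toNat)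

/-- Find the label of position `i` of the cycle: the first known state whose dataset cannot be told
apart from `D'_i`, or else a new state. The optional merging of `D'_i` into the dataset of a known
state is carried out only if the samples of the merged dataset are still `tmix` apart. -/
noncomputable def identify (P : Params X) (ℓ t₀ : ℕ) (x : ℕ → X) (n : ℕ) (m : PartialModel A)
    (i : ℕ) : PartialModel A × ℕ :=
  match m.states.find? fun s => !test P x (m.data s) (newTimes P A ℓ t₀ n i) with
  | some s =>
    (if P.merge i s = true ∧ Spaced P.tmix (m.data s ∪ newTimes P A ℓ t₀ n i) then
        { m with data := Function.update m.data s (m.data s ∪ newTimes P A ℓ t₀ n i) }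
      else m, s)
  | none =>
    let s' := m.states.sum + 1
    ({ states := m.states ++ [s']
       trans := Function.update m.trans s' fun _ => none
       data := Function.update m.data s' (newTimes P A ℓ t₀ n i) }, s')

/-- Identify the positions `0, …, i - 1` in order; the second component maps a position to its
label. -/
noncomputable def identifyAll (P : Params X) (ℓ t₀ : ℕ) (x : ℕ → X) (n : ℕ)
    (m : PartialModel A) : ℕ → PartialModel A × (ℕ → ℕ)
  | 0 => (m, fun _ => 0)
  | i + 1 =>
    let prev := identifyAll P ℓ t₀ x n m i
    let next := identify P ℓ t₀ x n prev.1 i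
    (next.1, Function.update prev.2 i next.2)

/-- Add the transitions out of the positions `0, …, i - 1` of the cycle. -/
def addTrans [DecidableEq A] {ℓ : ℕ} [NeZero ℓ] (â : Fin ℓ → A) (n : ℕ) (lab : ℕ → ℕ)
    (tr : ℕ → A → Option ℕ) : ℕ → ℕ → A → Option ℕ
  | 0 => tr
  | i + 1 =>
    let prev := addTrans â n lab tr i
    Function.update prev (lab i)
      (Function.update (prev (lab i)) (â (Fin.ofNat ℓ i)) (some (lab ((i + 1) % (ℓ * n)))))

/-- The subroutine CycleFind, called at time `t₀` with the action sequence `â` and the partial model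
`m`. Here `x t` is the observation made at time `t` while `â` is being looped from time `t₀` on; only
observations up to time `t₀ + steps` are read, and only through the oracle tests. -/
noncomputable def cycleFind [DecidableEq A] (P : Params X) {ℓ : ℕ} [NeZero ℓ] (â : Fin ℓ → A)
    (m : PartialModel A) (t₀ : ℕ) (x : ℕ → X) : Output A :=
  let n := findPeriod P A ℓ t₀ x P.N
  let steps := max (cInit P A ℓ) (cFull P A ℓ n)
  let res := identifyAll P ℓ t₀ x n m (ℓ * n)
  { model := { res.1 with trans := addTrans â n res.2 res.1.trans (ℓ * n) }
    curr := res.2 (steps % (ℓ * n))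
    steps := steps }

end CycleFind

/-! ### The inductive assumptions -/

/-- The partial model `m` at time `now` is correct, through the injective map `σ` from the learned
states to the true states; every dataset holds at least `nsamp` samples, collected up to now, at
least `tmix` steps apart. Here `lat t` is the true latent state at time `t`, that is, the latent
state of the observation made at time `t`. The sample times are fixed, non-random sets. -/
structure Consistent {S A : Type*} (T : S → A → S) (lat : ℕ → S) (now nsamp tmix : ℕ)
    (m : PartialModel A) (σ : ℕ → S) : Prop where
  nodup : m.states.Nodup
  inj : ∀ s ∈ m.states, ∀ s' ∈ m.states, σ s = σ s' → s = s'
  trans : ∀ s ∈ m.states, ∀ a s', m.trans s a = some s' → s' ∈ m.states ∧ σ s' = T (σ s) a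
  label : ∀ s ∈ m.states, ∀ t ∈ m.data s, lat t = σ s
  card : ∀ s ∈ m.states, nsamp ≤ (m.data s).card
  spaced : ∀ s ∈ m.states, Spaced tmix (m.data s)
  past : ∀ s ∈ m.states, ∀ t ∈ m.data s, t ≤ now

end STEEL

open STEEL

/-! The actions are fixed and the endogenous dynamics deterministic, so the latent sequence is fixed
and only the exogenous noise is random. Every test asked in a correct run has a predetermined right
answer; the output is the run in which all answers are right, and it remains to bound the
probability of a wrong one. Tests that should succeed never fail, since the indicator of a state
lies in the class (`test_eq_true`). Errors come only from separating data that share states.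

For these, conditioning at most a mixing time back bounds each demanded label by its stationary
probability plus 1/4 (`trajLaw_spaced_le`). Two observations of one state with opposite demanded
labels cost (p + 1/4)(q + 1/4) ≤ 9/16, where p + q = 1. Hence `k` such pairs cost (9/16)^k for a
fixed classifier, and a union bound over the class covers the oracle's data-dependent choice.

Pigeonhole on the times divisible by ℓ gives a cycle of period ℓn in which states at equal phase
modulo ℓ are distinct (`FollowsLoop.exists_period`). For the candidate n, the second dataset shows a
single state which the first one avoids, so the test succeeds; for a candidate n' > n, every block
contains a pair of equal states, so it likely fails. Thus n is recovered.

Each cycle position is then compared with the known states. Reference samples fixed in advance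
(`baseTimes`) make the bad events independent of merging and of the order of discovery, so
`Consistent.exists_identifyAll` yields a deterministic model off these events. Period detection and
identification each receive failure budget δ/(4|A|N). -/

namespace STEEL

open Filtration

/-! ### Markov property and emissions of the trajectory -/

section Trajectory

variable {E X S : Type*} [MeasurableSpace E] [MeasurableSpace X]
  {Q : S → Kernel E X} [∀ s, IsMarkovKernel (Q s)] {Te : Kernel E E} [IsMarkovKernel Te]
  {init π : Measure E} [IsProbabilityMeasure init] {lat : ℕ → S}

instance isProbabilityMeasure_trajLaw : IsProbabilityMeasure (trajLaw Q Te init lat) := by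
  unfold trajLaw; infer_instance

/-- Conditionally on an event of the past, the next pair follows the step kernel. -/
theorem setLIntegral_trajLaw_succ {n : ℕ} {H : Set (ℕ → E × X)}
    (hH : MeasurableSet[piLE (X := fun _ => E × X) n] H) {G : E × X → ENNReal}
    (hG : Measurable G) :
    ∫⁻ w in H, G (w (n + 1)) ∂(trajLaw Q Te init lat) =
      ∫⁻ w in H, ∫⁻ y, G y ∂(stepKernel Q Te (lat (n + 1)) (w n).1) ∂(trajLaw Q Te init lat) := by
  rw [piLE_eq_comap_frestrictLe] at hH
  obtain ⟨s, hs, rfl⟩ := hH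
  -- The event depends only on the coordinates up to `n`, so the joint law of the history and the
  -- next pair, a composition product, is all that matters.
  have key := Kernel.map_frestrictLe_trajMeasure_compProd_eq_map_trajMeasure
    (X := fun _ => E × X) (μ₀ := init.bind (Kernel.id ×ₖ Q (lat 0)))
    (κ := histKernel Q Te lat) (a := n)
  have h1 : ∫⁻ w in Preorder.frestrictLe n ⁻¹' s, G (w (n + 1)) ∂(trajLaw Q Te init lat) =
      ∫⁻ p in s ×ˢ Set.univ, G p.2
        ∂((trajLaw Q Te init lat).map fun x => (Preorder.frestrictLe n x, x (n + 1))) := by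
    rw [setLIntegral_map (hs.prod MeasurableSet.univ) (by fun_prop) (by fun_prop)]
    congr 2
    ext w; simp
  rw [h1]
  unfold trajLaw
  rw [← key, Measure.setLIntegral_compProd (by fun_prop) hs MeasurableSet.univ]
  simp only [Measure.restrict_univ]
  rw [setLIntegral_map hs _ (by fun_prop)]
  · rfl
  · exact (Measurable.lintegral_kernel_prod_right' (κ := histKernel Q Te lat n)
      (f := fun p => G p.2) (by fun_prop))

omit [IsMarkovKernel Te] in
theorem lintegral_stepKernel (s : S) (e : E) {G : E × X → ENNReal} (hG : Measurable G) :
    ∫⁻ y, G y ∂(stepKernel Q Te s e) = ∫⁻ e', ∫⁻ x, G (e', x) ∂(Q s e') ∂(Te e) := by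
  unfold stepKernel
  rw [Kernel.lintegral_comp _ _ _ hG]
  refine lintegral_congr fun e' => ?_
  rw [Kernel.lintegral_prod _ _ _ hG]
  rw [Kernel.id_apply, lintegral_dirac']
  exact Measurable.lintegral_prod_right' (ν := Q s e') hG

/-- The endogenous labels drop out on iteration, because the exogenous coordinate of `stepKernel`
moves by `Te` alone. -/
theorem setLIntegral_trajLaw_pow {n : ℕ} (m : ℕ) {H : Set (ℕ → E × X)}
    (hH : MeasurableSet[piLE (X := fun _ => E × X) n] H) {g : E → ENNReal}
    (hg : Measurable g) :
    ∫⁻ w in H, g (w (n + m)).1 ∂(trajLaw Q Te init lat) =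
      ∫⁻ w in H, ∫⁻ e, g e ∂((Te ^ m) (w n).1) ∂(trajLaw Q Te init lat) := by
  induction m generalizing g with
  | zero =>
    refine lintegral_congr fun w => ?_
    have : (Te ^ 0 : Kernel E E) = Kernel.id := pow_zero Te
    rw [this, Kernel.id_apply, lintegral_dirac' _ hg]; rfl
  | succ m ih =>
    have hH' : MeasurableSet[piLE (X := fun _ => E × X) (n + m)] H :=
      (piLE (X := fun _ => E × X)).mono (Nat.le_add_right n m) _ hH
    have := setLIntegral_trajLaw_succ (Q := Q) (Te := Te) (init := init) (lat := lat) hH'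
      (G := fun y => g y.1) (by fun_prop)
    rw [← add_assoc, this]
    have h2 : ∀ e, ∫⁻ y, g y.1 ∂(stepKernel Q Te (lat (n + m + 1)) e) = ∫⁻ e', g e' ∂(Te e) := by
      intro e
      rw [lintegral_stepKernel _ _ (by fun_prop)]
      simp
    simp only [h2]
    rw [ih (Measurable.lintegral_kernel hg)]
    refine lintegral_congr fun w => ?_
    have : (Te ^ (m + 1) : Kernel E E) = Te ∘ₖ (Te ^ m) := pow_succ' Te m
    rw [this, Kernel.lintegral_comp _ _ _ hg]

/-- Given the past before time `n + 1`, the observation at `n + 1` is emitted by the exogenous state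
at that time. -/
theorem measure_inter_obs {n : ℕ} {H : Set (ℕ → E × X)}
    (hH : MeasurableSet[piLE (X := fun _ => E × X) n] H) {B : Set X} (hB : MeasurableSet B) :
    trajLaw Q Te init lat (H ∩ {w | (w (n + 1)).2 ∈ B}) =
      ∫⁻ w in H, Q (lat (n + 1)) (w (n + 1)).1 B ∂(trajLaw Q Te init lat) := by
  have hmB : Measurable fun e => Q (lat (n + 1)) e B := Kernel.measurable_coe _ hB
  rw [setLIntegral_trajLaw_succ hH (G := fun y => Q (lat (n + 1)) y.1 B) (by fun_prop)]
  -- Both sides reduce to the average of the emission probability over one step of the exogenous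
  -- chain.
  have h1 := setLIntegral_trajLaw_succ (Q := Q) (Te := Te) (init := init) (lat := lat) hH
    (G := fun y => B.indicator 1 y.2) ((measurable_one.indicator hB).comp measurable_snd)
  have hms : MeasurableSet {w : ℕ → E × X | (w (n + 1)).2 ∈ B} :=
    (measurable_snd.comp (measurable_pi_apply (n + 1))) hB
  have h2 : ∫⁻ w in H, B.indicator 1 (w (n + 1)).2 ∂(trajLaw Q Te init lat) =
      trajLaw Q Te init lat (H ∩ {w | (w (n + 1)).2 ∈ B}) := by
    rw [Set.inter_comm, ← Measure.restrict_apply hms, ← lintegral_indicator_one hms]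
    rfl
  rw [← h2, h1]
  refine lintegral_congr fun w => ?_
  rw [lintegral_stepKernel (G := fun y => B.indicator 1 y.2) _ _
    ((measurable_one.indicator hB).comp measurable_snd), lintegral_stepKernel _ _ (by fun_prop)]
  refine lintegral_congr fun e => ?_
  rw [lintegral_indicator_one hB]
  simp

omit [IsProbabilityMeasure init] in
-- Time 0 is preceded by no step and escapes `measure_inter_obs`; `ae_label` needs it separately.
theorem trajLaw_obs_zero {B : Set X} (hB : MeasurableSet B) :
    trajLaw Q Te init lat {w | (w 0).2 ∈ B} = ∫⁻ e, Q (lat 0) e B ∂init := by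
  have hm : MeasurableSet {y : E × X | y.2 ∈ B} := measurable_snd hB
  have hmap : (trajLaw Q Te init lat).map (fun w => w 0) =
      init.bind (Kernel.id ×ₖ Q (lat 0)) := by
    have hcomp : (fun w : ℕ → E × X => w 0) =
        (fun v : (i : Finset.Iic 0) → (fun _ : ℕ => E × X) i => v ⟨0, by simp⟩) ∘
          Preorder.frestrictLe 0 := rfl
    rw [hcomp, ← Measure.map_map (by fun_prop) (by fun_prop)]
    unfold trajLaw Kernel.trajMeasure
    rw [Measure.map_comp _ _ (by fun_prop), Kernel.traj_map_frestrictLe,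
      Kernel.partialTraj_self, Measure.id_comp, Measure.map_map (by fun_prop) (by fun_prop)]
    exact Measure.map_id
  have h1 : trajLaw Q Te init lat {w | (w 0).2 ∈ B} =
      (trajLaw Q Te init lat).map (fun w => w 0) {y | y.2 ∈ B} := by
    rw [Measure.map_apply (by fun_prop) hm]; rfl
  rw [h1, hmap, Measure.bind_apply hm (Kernel.aemeasurable _)]
  refine lintegral_congr fun e => ?_
  rw [Kernel.prod_apply, Kernel.id_apply, Measure.prod_apply hm,
    lintegral_dirac' _ (measurable_measure_prodMk_left hm)]
  rfl

theorem ae_label [Countable S] {φ : X → S} (hφ : ∀ s, MeasurableSet {x | φ x = s})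
    (hQ : ∀ s e, ∀ᵐ x ∂(Q s e), φ x = s) :
    ∀ᵐ w ∂(trajLaw Q Te init lat), ∀ t, φ (w t).2 = lat t := by
  rw [ae_all_iff]
  intro t
  have hz : ∀ e, Q (lat t) e {x | φ x = lat t}ᶜ = 0 := fun e => hQ (lat t) e
  rw [ae_iff]
  cases t with
  | zero =>
    have := trajLaw_obs_zero (Q := Q) (Te := Te) (init := init) (lat := lat) (hφ (lat 0)).compl
    simp only [hz, lintegral_zero] at this
    exact this
  | succ n =>
    have := measure_inter_obs (Q := Q) (Te := Te) (init := init) (lat := lat) (n := n)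
      (H := Set.univ) MeasurableSet.univ (hφ (lat (n + 1))).compl
    simp only [hz, lintegral_zero, Set.univ_inter] at this
    exact this

end Trajectory

/-! ### From total variation to expectations -/

section Mixing

variable {E : Type*} [MeasurableSpace E]

/-- Layer cake: the integral of a [0, 1]-valued function averages the measures of its superlevel
sets over thresholds in (0, 1), so the error ε is integrated over an interval of length 1. -/
theorem lintegral_le_lintegral_add_of_measure_le {μ ν : Measure E} {ε : ENNReal}
    (h : ∀ B, MeasurableSet B → μ B ≤ ν B + ε) {g : E → ENNReal} (hg : Measurable g)
    (hg1 : ∀ e, g e ≤ 1) : ∫⁻ e, g e ∂μ ≤ ∫⁻ e, g e ∂ν + ε := by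
  have hlt : ∀ e, g e < ⊤ := fun e => (hg1 e).trans_lt ENNReal.one_lt_top
  have layer : ∀ ρ : Measure E, ∫⁻ e, g e ∂ρ =
      ∫⁻ t in Set.Ioo (0 : ℝ) 1, ρ {e | t < (g e).toReal} := by
    intro ρ
    have h1 := lintegral_eq_lintegral_meas_lt ρ (f := fun e => (g e).toReal)
      (Filter.Eventually.of_forall fun e => ENNReal.toReal_nonneg) (by fun_prop)
    simp only [ENNReal.ofReal_toReal (hlt _).ne] at h1
    rw [h1]
    rw [← lintegral_indicator measurableSet_Ioi, ← lintegral_indicator measurableSet_Ioo]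
    refine lintegral_congr fun t => ?_
    by_cases ht : t ∈ Set.Ioo (0 : ℝ) 1
    · rw [Set.indicator_of_mem ht, Set.indicator_of_mem (Set.mem_Ioi.mpr ht.1)]
    rw [Set.indicator_of_notMem ht]
    refine Set.indicator_apply_eq_zero.mpr fun ht0 => ?_
    have ht1 : 1 ≤ t := by
      by_contra hlt'
      exact ht ⟨ht0, not_le.mp hlt'⟩
    convert measure_empty (μ := ρ)
    ext e
    simp only [Set.mem_ofPred_eq, Set.mem_empty_iff_false, iff_false, not_lt]
    refine le_trans ?_ ht1
    exact ENNReal.toReal_le_of_le_ofReal zero_le_one (by simpa using hg1 e)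
  rw [layer μ, layer ν]
  calc ∫⁻ t in Set.Ioo (0 : ℝ) 1, μ {e | t < (g e).toReal}
      ≤ ∫⁻ t in Set.Ioo (0 : ℝ) 1, (ν {e | t < (g e).toReal} + ε) :=
        lintegral_mono fun t => h _ (measurableSet_lt measurable_const (by fun_prop))
    _ = (∫⁻ t in Set.Ioo (0 : ℝ) 1, ν {e | t < (g e).toReal}) + ε := by
        rw [lintegral_add_right _ measurable_const]
        simp

theorem measure_le_add_tvDist (μ ν : Measure E) [IsProbabilityMeasure μ] [IsProbabilityMeasure ν]
    {B : Set E} (hB : MeasurableSet B) : μ.real B ≤ ν.real B + tvDist μ ν := by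
  have hbdd : BddAbove (Set.range fun B : {B : Set E // MeasurableSet B} =>
      |μ.real B.1 - ν.real B.1|) := by
    refine ⟨1, ?_⟩
    rintro _ ⟨C, rfl⟩
    rw [abs_le]
    have h1 := measureReal_le_one (μ := μ) (s := C.1)
    have h2 := measureReal_le_one (μ := ν) (s := C.1)
    have h3 := measureReal_nonneg (μ := μ) (s := C.1)
    have h4 := measureReal_nonneg (μ := ν) (s := C.1)
    constructor <;> linarith
  have := (le_abs_self _).trans (le_ciSup hbdd ⟨B, hB⟩)
  unfold tvDist
  linarith

/-- If the chain has mixed by time `t`, the law of its state after some number `m ≤ t` of steps is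
close to `π` when tested against functions with values in `[0, 1]`. -/
theorem exists_pow_lintegral_le {Te : Kernel E E} [IsMarkovKernel Te] {π : Measure E}
    [IsProbabilityMeasure π] {t : ℕ} (h : mixingTime Te π (1 / 4) ≤ (t : ℕ∞)) :
    ∃ m ≤ t, ∀ g : E → ENNReal, Measurable g → (∀ e, g e ≤ 1) → ∀ e,
      ∫⁻ e', g e' ∂((Te ^ m) e) ≤ ∫⁻ e', g e' ∂π + ENNReal.ofReal (1 / 4) := by
  unfold mixingTime at h
  have hne : {t : ℕ | ∀ e, tvDist ((Te ^ t) e) π ≤ 1 / 4}.Nonempty := by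
    by_contra hne
    rw [Set.not_nonempty_iff_eq_empty] at hne
    simp only [hne, Set.image_empty, sInf_empty, top_le_iff] at h
    exact ENat.natCast_ne_top t h
  -- `ℕ∞` is well-ordered, so the infimum is attained and `m` is the mixing time itself. No
  -- monotonicity of the distance in time is needed.
  have hmem := csInf_mem (hne.image fun t : ℕ => (t : ℕ∞))
  obtain ⟨m, hm, hm'⟩ := hmem
  refine ⟨m, ?_, fun g hg hg1 e => ?_⟩
  · rw [← hm'] at h
    exact Nat.cast_le.mp h
  · have hmk : IsMarkovKernel (Te ^ m) := by
      clear hm hm' hne h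
      induction m with
      | zero =>
        have : (Te ^ 0 : Kernel E E) = Kernel.id := pow_zero Te
        rw [this]; infer_instance
      | succ m ih =>
        have : (Te ^ (m + 1) : Kernel E E) = Te ∘ₖ (Te ^ m) := pow_succ' Te m
        rw [this]; infer_instance
    refine lintegral_le_lintegral_add_of_measure_le (fun B hB => ?_) hg hg1
    have := measure_le_add_tvDist ((Te ^ m) e) π hB
    rw [← ENNReal.ofReal_toReal (measure_ne_top ((Te ^ m) e) B),
      ← ENNReal.ofReal_toReal (measure_ne_top π B), ← ENNReal.ofReal_add (by simp) (by norm_num)]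
    exact ENNReal.ofReal_le_ofReal (this.trans (add_le_add le_rfl (hm e)))

end Mixing

/-! ### Near-independence of spaced observations -/

section Spaced

variable {E X S : Type*} [MeasurableSpace E] [MeasurableSpace X]
  {Q : S → Kernel E X} [∀ s, IsMarkovKernel (Q s)] {Te : Kernel E E} [IsMarkovKernel Te]
  {init π : Measure E} [IsProbabilityMeasure init] [IsProbabilityMeasure π] {lat : ℕ → S}

/-- Observations made at times that are at least a mixing time apart are nearly independent. -/
theorem trajLaw_spaced_le {tmix : ℕ} (h1 : 1 ≤ tmix)
    (hmix : mixingTime Te π (1 / 4) ≤ (tmix : ℕ∞)) {τ : Finset ℕ} (hτ : Spaced tmix τ)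
    (hτ0 : ∀ t ∈ τ, tmix ≤ t) {B : ℕ → Set X} (hB : ∀ t, MeasurableSet (B t)) :
    trajLaw Q Te init lat {w | ∀ t ∈ τ, (w t).2 ∈ B t} ≤
      ∏ t ∈ τ, (∫⁻ e, Q (lat t) e (B t) ∂π + ENNReal.ofReal (1 / 4)) := by
  obtain ⟨m, hm, hmix⟩ := exists_pow_lintegral_le hmix
  -- The latest time is split off; the events at all other times are already decided `tmix` steps
  -- before it.
  induction τ using Finset.induction_on_max with
  | empty => simp
  | insert a τ hlt ih =>
    have ha : tmix ≤ a := hτ0 a (Finset.mem_insert_self a τ)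
    have hnot : a ∉ τ := fun h => (hlt a h).false
    specialize ih (fun i hi j hj => hτ i (Finset.mem_insert_of_mem hi) j
      (Finset.mem_insert_of_mem hj)) fun t ht => hτ0 t (Finset.mem_insert_of_mem ht)
    rw [Finset.prod_insert hnot, mul_comm]
    set H : Set (ℕ → E × X) := {w | ∀ t ∈ τ, (w t).2 ∈ B t} with hHdef
    have hH : MeasurableSet[piLE (X := fun _ => E × X) (a - tmix)] H := by
      have : H = ⋂ t ∈ τ, {w : ℕ → E × X | (w t).2 ∈ B t} := by
        ext w; simp [hHdef]
      rw [this]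
      refine Finset.measurableSet_biInter (m := piLE (X := fun _ => E × X) (a - tmix)) τ
        fun t ht => ?_
      have hta : t ≤ a - tmix := by
        have := hτ t (Finset.mem_insert_of_mem ht) a (Finset.mem_insert_self a τ) (hlt t ht)
        omega
      rw [piLE_eq_comap_frestrictLe]
      refine ⟨{v | (v ⟨t, Finset.mem_Iic.mpr hta⟩).2 ∈ B t}, ?_, rfl⟩
      exact (measurable_snd.comp (measurable_pi_apply _)) (hB t)
    have hmono : ∀ {k}, a - tmix ≤ k → MeasurableSet[piLE (X := fun _ => E × X) k] H :=
      fun hk => (piLE (X := fun _ => E × X)).mono hk _ hH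
    have hset : {w : ℕ → E × X | ∀ t ∈ insert a τ, (w t).2 ∈ B t} =
        H ∩ {w | (w a).2 ∈ B a} := by
      ext w
      simp [hHdef, and_comm]
    rw [hset]
    obtain ⟨b, rfl⟩ : ∃ b, a = b + 1 := ⟨a - 1, by omega⟩
    -- Conditioning takes place exactly `m` steps back, which is no earlier than `tmix` steps back.
    -- Even the earliest sample must be at time at least `tmix` for this.
    obtain ⟨c, hc⟩ : ∃ c, b + 1 = c + m := ⟨b + 1 - m, by omega⟩
    have hmeas : Measurable fun e => Q (lat (b + 1)) e (B (b + 1)) :=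
      Kernel.measurable_coe _ (hB _)
    rw [measure_inter_obs (hmono (by omega)) (hB _)]
    have hpow := setLIntegral_trajLaw_pow (Q := Q) (Te := Te) (init := init) (lat := lat) (n := c) m
      (hmono (k := c) (by omega)) hmeas
    rw [← hc] at hpow
    rw [hpow]
    calc ∫⁻ w in H, ∫⁻ e, Q (lat (b + 1)) e (B (b + 1)) ∂((Te ^ m) (w c).1)
          ∂(trajLaw Q Te init lat)
        ≤ ∫⁻ _ in H, (∫⁻ e, Q (lat (b + 1)) e (B (b + 1)) ∂π + ENNReal.ofReal (1 / 4))
          ∂(trajLaw Q Te init lat) :=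
          lintegral_mono fun w => hmix _ hmeas (fun e => prob_le_one) _
      _ = (∫⁻ e, Q (lat (b + 1)) e (B (b + 1)) ∂π + ENNReal.ofReal (1 / 4)) *
          trajLaw Q Te init lat H := by
          rw [setLIntegral_const]
      _ ≤ _ := by
          rw [mul_comm]
          exact mul_le_mul_left ih _

end Spaced

/-! ### Probability that a fixed classifier separates -/

section Separation

theorem separates_sample_iff {X : Type*} {f : X → Bool} {x : ℕ → X} {τ₀ τ₁ : Finset ℕ} :
    Separates f (sample x τ₀) (sample x τ₁) ↔
      (∀ t ∈ τ₀, f (x t) = false) ∧ ∀ t ∈ τ₁, f (x t) = true := by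
  simp [Separates, sample]

/-- Discarding samples only enlarges the event of separation, so bounds for well-spaced subsamples
transfer to the full test. -/
theorem Separates.mono {X : Type*} {f : X → Bool} {x : ℕ → X} {τ₀ τ₁ τ₀' τ₁' : Finset ℕ}
    (h : Separates f (sample x τ₀) (sample x τ₁)) (h₀ : τ₀' ⊆ τ₀) (h₁ : τ₁' ⊆ τ₁) :
    Separates f (sample x τ₀') (sample x τ₁') := by
  rw [separates_sample_iff] at h ⊢
  exact ⟨fun t ht => h.1 t (h₀ ht), fun t ht => h.2 t (h₁ ht)⟩

variable {E X S : Type*} [MeasurableSpace E] [MeasurableSpace X]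
  {Q : S → Kernel E X} [∀ s, IsMarkovKernel (Q s)] {Te : Kernel E E} [IsMarkovKernel Te]
  {init π : Measure E} [IsProbabilityMeasure init] [IsProbabilityMeasure π] {lat : ℕ → S}

/-- The stationary probability that an observation of the endogenous state `s` is classified as
`b` by `f`. -/
noncomputable def classProb (Q : S → Kernel E X) (π : Measure E) (f : X → Bool) (b : Bool) (s : S) :
    ℝ :=
  (∫⁻ e, Q s e {x | f x = b} ∂π).toReal

omit [∀ s, IsMarkovKernel (Q s)] [IsProbabilityMeasure π] in
theorem classProb_nonneg (f : X → Bool) (b : Bool) (s : S) : 0 ≤ classProb Q π f b s :=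
  ENNReal.toReal_nonneg

theorem lintegral_class_le_one (f : X → Bool) (b : Bool) (s : S) :
    ∫⁻ e, Q s e {x | f x = b} ∂π ≤ 1 := by
  calc ∫⁻ e, Q s e {x | f x = b} ∂π ≤ ∫⁻ _, 1 ∂π := lintegral_mono fun e => prob_le_one
    _ = 1 := by simp

theorem classProb_false_add_true {f : X → Bool} (hf : Measurable f) (s : S) :
    classProb Q π f false s + classProb Q π f true s = 1 := by
  unfold classProb
  rw [← ENNReal.toReal_add
    ((lintegral_class_le_one f false s).trans_lt ENNReal.one_lt_top).ne
    ((lintegral_class_le_one f true s).trans_lt ENNReal.one_lt_top).ne,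
    ← lintegral_add_left (f := fun e => Q s e {x | f x = false})
      (Kernel.measurable_coe _ (hf (measurableSet_singleton false)))]
  have : ∀ e, Q s e {x | f x = false} + Q s e {x | f x = true} = 1 := by
    intro e
    have h := prob_add_prob_compl (μ := Q s e) (s := {x | f x = false})
      (hf (measurableSet_singleton false))
    rw [← h]
    congr 2
    ext x
    simp
  simp [this]

/-- The two factors sum to 3/2, so their product is at most (3/4)². This is the source of the base
9/16 in the sample sizes. -/
theorem classProb_mul_le {f : X → Bool} (hf : Measurable f) (s : S) :
    (classProb Q π f false s + 1 / 4) * (classProb Q π f true s + 1 / 4) ≤ 9 / 16 := by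
  have h := classProb_false_add_true (Q := Q) (π := π) hf s
  nlinarith [sq_nonneg (classProb Q π f false s - classProb Q π f true s)]

theorem measureReal_separates_le {tmix : ℕ} (h1 : 1 ≤ tmix)
    (hmix : mixingTime Te π (1 / 4) ≤ (tmix : ℕ∞)) {τ₀ τ₁ : Finset ℕ} (hd : Disjoint τ₀ τ₁)
    (hτ : Spaced tmix (τ₀ ∪ τ₁)) (hτ0 : ∀ t ∈ τ₀ ∪ τ₁, tmix ≤ t) {f : X → Bool}
    (hf : Measurable f) :
    (trajLaw Q Te init lat).real
        {w | Separates f (sample (fun t => (w t).2) τ₀) (sample (fun t => (w t).2) τ₁)} ≤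
      (∏ t ∈ τ₀, (classProb Q π f false (lat t) + 1 / 4)) *
        ∏ t ∈ τ₁, (classProb Q π f true (lat t) + 1 / 4) := by
  -- As the two sets of times are disjoint, the demanded label is a function of the time.
  have key := trajLaw_spaced_le (Q := Q) (Te := Te) (init := init) (π := π) (lat := lat) h1 hmix hτ
    hτ0 (B := fun t => {x | f x = decide (t ∈ τ₁)})
    fun t => hf (measurableSet_singleton (decide (t ∈ τ₁)))
  have hset : {w : ℕ → E × X | Separates f (sample (fun t => (w t).2) τ₀)
      (sample (fun t => (w t).2) τ₁)} ⊆
      {w | ∀ t ∈ τ₀ ∪ τ₁, (w t).2 ∈ {x | f x = decide (t ∈ τ₁)}} := by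
    intro w hw t ht
    rw [Set.mem_ofPred_eq, separates_sample_iff] at hw
    by_cases h : t ∈ τ₁
    · simp [h, hw.2 t h]
    · have ht0 : t ∈ τ₀ := by simpa [h] using ht
      simp [h, hw.1 t ht0]
  have hreal := ENNReal.toReal_mono ?_ ((measure_mono hset).trans key)
  · refine hreal.trans (le_of_eq ?_)
    rw [ENNReal.toReal_prod, Finset.prod_union hd]
    have hadd : ∀ b s, (∫⁻ e, Q s e {x | f x = b} ∂π + ENNReal.ofReal (1 / 4)).toReal =
        classProb Q π f b s + 1 / 4 := by
      intro b s
      rw [ENNReal.toReal_add ((lintegral_class_le_one f b s).trans_lt ENNReal.one_lt_top).ne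
        ENNReal.ofReal_ne_top, ENNReal.toReal_ofReal (by norm_num)]
      rfl
    congr 1
    · refine Finset.prod_congr rfl fun t ht => ?_
      have : t ∉ τ₁ := Finset.disjoint_left.mp hd ht
      simp only [this, decide_false, hadd]
    · refine Finset.prod_congr rfl fun t ht => ?_
      simp only [ht, decide_true, hadd]
  · refine ENNReal.prod_ne_top fun t _ => ENNReal.add_ne_top.mpr ⟨?_, ENNReal.ofReal_ne_top⟩
    exact ((lintegral_class_le_one f _ (lat t)).trans_lt ENNReal.one_lt_top).ne

/-- Samples of one and the same endogenous state are unlikely to be separated. -/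
theorem measureReal_separates_le_of_same {tmix : ℕ} (h1 : 1 ≤ tmix)
    (hmix : mixingTime Te π (1 / 4) ≤ (tmix : ℕ∞)) {τ₀ τ₁ : Finset ℕ} (hd : Disjoint τ₀ τ₁)
    (hτ : Spaced tmix (τ₀ ∪ τ₁)) (hτ0 : ∀ t ∈ τ₀ ∪ τ₁, tmix ≤ t) {f : X → Bool}
    (hf : Measurable f) {k : ℕ} (h₀ : τ₀.card = k) (h₁ : τ₁.card = k) {v : S}
    (hv : ∀ t ∈ τ₀ ∪ τ₁, lat t = v) :
    (trajLaw Q Te init lat).real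
        {w | Separates f (sample (fun t => (w t).2) τ₀) (sample (fun t => (w t).2) τ₁)} ≤
      (9 / 16) ^ k := by
  refine (measureReal_separates_le h1 hmix hd hτ hτ0 hf).trans ?_
  have hp₀ : ∀ t ∈ τ₀, classProb Q π f false (lat t) + 1 / 4 = classProb Q π f false v + 1 / 4 :=
    fun t ht => by rw [hv t (Finset.mem_union_left _ ht)]
  have hp₁ : ∀ t ∈ τ₁, classProb Q π f true (lat t) + 1 / 4 = classProb Q π f true v + 1 / 4 :=
    fun t ht => by rw [hv t (Finset.mem_union_right _ ht)]
  rw [Finset.prod_congr rfl hp₀, Finset.prod_congr rfl hp₁, Finset.prod_const, Finset.prod_const,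
    h₀, h₁, ← mul_pow]
  refine pow_le_pow_left₀ (mul_nonneg ?_ ?_) (classProb_mul_le hf v) k
  · linarith [classProb_nonneg (Q := Q) (π := π) f false v]
  · linarith [classProb_nonneg (Q := Q) (π := π) f true v]

/-- Samples that are matched in pairs of equal endogenous states are unlikely to be separated. -/
theorem measureReal_separates_le_of_paired {tmix : ℕ} (h1 : 1 ≤ tmix)
    (hmix : mixingTime Te π (1 / 4) ≤ (tmix : ℕ∞)) {τ₀ τ₁ : Finset ℕ} {k : ℕ} {a b : ℕ → ℕ}
    (hb0 : tmix ≤ b 0) (hba : ∀ i < k, b i + tmix ≤ a i)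
    (hab : ∀ i, i + 1 < k → a i + tmix ≤ b (i + 1))
    (ha : ∀ i < k, a i ∈ τ₀) (hb : ∀ i < k, b i ∈ τ₁)
    (hlat : ∀ i < k, lat (a i) = lat (b i)) {f : X → Bool} (hf : Measurable f) :
    (trajLaw Q Te init lat).real
        {w | Separates f (sample (fun t => (w t).2) τ₀) (sample (fun t => (w t).2) τ₁)} ≤
      (9 / 16) ^ k := by
  -- The times interleave as b 0, a 0, b 1, a 1, … with steps of at least `tmix`; injectivity,
  -- disjointness and spacing all follow from this chain.
  have hlt : ∀ i j, i < j → j < k → a i + tmix ≤ b j := by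
    intro i j hij hj
    induction j, hij using Nat.le_induction with
    | base => exact hab i hj
    | succ j hij ih =>
      have h2 := ih (by omega)
      have h3 := hba j (by omega)
      have h4 := hab j hj
      omega
  have hbge : ∀ i < k, tmix ≤ b i := by
    intro i hi
    rcases Nat.eq_zero_or_pos i with rfl | h
    · exact hb0
    · have := hlt 0 i h hi
      omega
  have hainj : Set.InjOn a (Finset.range k) := by
    intro i hi j hj hij
    simp only [Finset.coe_range, Set.mem_Iio] at hi hj
    by_contra hne
    rcases Nat.lt_or_gt_of_ne hne with h | h
    · have h2 := hlt i j h hj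
      have h3 := hba j hj
      omega
    · have h2 := hlt j i h hi
      have h3 := hba i hi
      omega
  have hbinj : Set.InjOn b (Finset.range k) := by
    intro i hi j hj hij
    simp only [Finset.coe_range, Set.mem_Iio] at hi hj
    by_contra hne
    rcases Nat.lt_or_gt_of_ne hne with h | h
    · have h2 := hlt i j h hj
      have h3 := hba i hi
      omega
    · have h2 := hlt j i h hi
      have h3 := hba j hj
      omega
  have hsub : {w : ℕ → E × X | Separates f (sample (fun t => (w t).2) τ₀)
      (sample (fun t => (w t).2) τ₁)} ⊆
      {w | Separates f (sample (fun t => (w t).2) ((Finset.range k).image a))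
        (sample (fun t => (w t).2) ((Finset.range k).image b))} := by
    intro w hw
    refine Separates.mono hw ?_ ?_
    · intro t ht
      obtain ⟨i, hi, rfl⟩ := Finset.mem_image.mp ht
      exact ha i (Finset.mem_range.mp hi)
    · intro t ht
      obtain ⟨i, hi, rfl⟩ := Finset.mem_image.mp ht
      exact hb i (Finset.mem_range.mp hi)
  refine (measureReal_mono hsub).trans ?_
  have hd : Disjoint ((Finset.range k).image a) ((Finset.range k).image b) := by
    rw [Finset.disjoint_left]
    rintro t h h'
    obtain ⟨i, hi, rfl⟩ := Finset.mem_image.mp h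
    obtain ⟨j, hj, hij⟩ := Finset.mem_image.mp h'
    rw [Finset.mem_range] at hi hj
    have h2 := hba i hi
    have h3 := hba j hj
    rcases Nat.lt_trichotomy i j with h | rfl | h
    · have := hlt i j h hj
      omega
    · omega
    · have := hlt j i h hi
      omega
  refine (measureReal_separates_le h1 hmix hd ?_ ?_ hf).trans ?_
  · intro s hs t ht hst
    simp only [Finset.mem_union, Finset.mem_image, Finset.mem_range] at hs ht
    rcases hs with ⟨i, hi, rfl⟩ | ⟨i, hi, rfl⟩ <;> rcases ht with ⟨j, hj, rfl⟩ | ⟨j, hj, rfl⟩ <;>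
    · have h2 := hba i hi
      have h3 := hba j hj
      rcases Nat.lt_trichotomy i j with h | rfl | h
      · have := hlt i j h hj
        omega
      · omega
      · have := hlt j i h hi
        omega
  · intro t ht
    simp only [Finset.mem_union, Finset.mem_image, Finset.mem_range] at ht
    rcases ht with ⟨i, hi, rfl⟩ | ⟨i, hi, rfl⟩
    · have h2 := hba i hi
      have h3 := hbge i hi
      omega
    · exact hbge i hi
  · rw [Finset.prod_image hainj, Finset.prod_image hbinj, ← Finset.prod_mul_distrib]
    calc _ ≤ ∏ i ∈ Finset.range k, (9 / 16 : ℝ) := by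
          refine Finset.prod_le_prod (fun i _ => ?_) fun i hi => ?_
          · have h2 := classProb_nonneg (Q := Q) (π := π) f false (lat (a i))
            have h3 := classProb_nonneg (Q := Q) (π := π) f true (lat (b i))
            positivity
          · rw [hlat i (Finset.mem_range.mp hi)]
            exact classProb_mul_le hf _
      _ = _ := by rw [Finset.prod_const, Finset.card_range]

end Separation

/-! ### Eventual periodicity of a looped action sequence -/

section Cycle

variable {S A : Type*} [Fintype S] {ℓ : ℕ} [NeZero ℓ]

/-- A sequence of states that follows `T` while the actions of `â` are looped. -/
def FollowsLoop (T : S → A → S) (â : Fin ℓ → A) (h : ℕ → S) : Prop :=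
  ∀ j, h (j + 1) = T (h j) (â (Fin.ofNat ℓ j))

theorem fin_ofNat_eq_of_modEq {i j : ℕ} (h : i ≡ j [MOD ℓ]) : Fin.ofNat ℓ i = Fin.ofNat ℓ j :=
  Fin.ext h

omit [Fintype S] in
-- The state together with the phase modulo ℓ determines the whole future.
theorem FollowsLoop.add_eq {T : S → A → S} {â : Fin ℓ → A} {h : ℕ → S} (hh : FollowsLoop T â h)
    {i j : ℕ} (hij : i ≡ j [MOD ℓ]) (heq : h i = h j) (d : ℕ) : h (i + d) = h (j + d) := by
  induction d with
  | zero => exact heq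
  | succ d ih =>
    rw [← add_assoc, ← add_assoc, hh, hh, ih, fin_ofNat_eq_of_modEq (hij.add_right d)]

/-- Looping a sequence of `ℓ` actions leads into a cycle of `ℓ * n` steps, of which the positions
that agree modulo `ℓ` carry distinct states. -/
theorem FollowsLoop.exists_period {T : S → A → S} {â : Fin ℓ → A} {h : ℕ → S}
    (hh : FollowsLoop T â h) :
    ∃ n, 0 < n ∧ n ≤ Fintype.card S ∧
      (∀ i j, (Fintype.card S - n) * ℓ ≤ i → (Fintype.card S - n) * ℓ ≤ j →
        i ≡ j [MOD ℓ * n] → h i = h j) ∧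
      ∀ b, (Fintype.card S - n) * ℓ ≤ b → ∀ i j, h (b + i * ℓ) = h (b + j * ℓ) → i ≡ j [MOD n] := by
  classical
  have hℓ : 0 < ℓ := Nat.pos_of_ne_zero (NeZero.ne ℓ)
  -- Pigeonhole on the times 0, ℓ, …, |S|ℓ. The earliest repetition j₀ of some i₀ gives n = j₀ - i₀,
  -- and j₀ ≤ |S| bounds the preperiod i₀ by |S| - n.
  have hex : ∃ j, ∃ i < j, h (i * ℓ) = h (j * ℓ) ∧ j ≤ Fintype.card S := by
    obtain ⟨i, j, hij, heq⟩ := Fintype.exists_ne_map_eq_of_card_lt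
      (fun i : Fin (Fintype.card S + 1) => h (i * ℓ)) (by simp)
    have hi := i.2
    have hj := j.2
    rcases Nat.lt_or_gt_of_ne (Fin.val_ne_of_ne hij) with hlt | hlt
    · exact ⟨j, i, hlt, heq, by omega⟩
    · exact ⟨i, j, hlt, heq.symm, by omega⟩
  obtain ⟨i₀, hi₀, heq, hle⟩ := Nat.find_spec hex
  have hmin := fun {m} => Nat.find_min hex (m := m)
  set j₀ := Nat.find hex with hj₀
  have hperiod : ∀ d, i₀ * ℓ ≤ d → ∀ c, h (d + c * (ℓ * (j₀ - i₀))) = h d := by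
    have hstep : ∀ d, i₀ * ℓ ≤ d → h (d + ℓ * (j₀ - i₀)) = h d := by
      intro d hd
      obtain ⟨e, rfl⟩ := Nat.exists_eq_add_of_le hd
      have hmod : j₀ * ℓ ≡ i₀ * ℓ [MOD ℓ] := by
        simp [Nat.ModEq]
      have := hh.add_eq hmod heq.symm e
      rw [← this]
      congr 1
      have : j₀ * ℓ = i₀ * ℓ + ℓ * (j₀ - i₀) := by
        obtain ⟨k, hk⟩ := Nat.exists_eq_add_of_le hi₀.le
        rw [hk]
        simp
        ring
      omega
    intro d hd c
    induction c with
    | zero => simp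
    | succ c ih => rw [← ih, ← hstep (d + c * (ℓ * (j₀ - i₀))) (by omega)]; congr 1; ring
  have hdistinct : ∀ i j, i < j → j < j₀ → h (i * ℓ) ≠ h (j * ℓ) := by
    intro i j hij hj he
    exact hmin hj ⟨i, hij, he, by omega⟩
  have hK : i₀ ≤ Fintype.card S - (j₀ - i₀) := by omega
  have hKℓ : i₀ * ℓ ≤ (Fintype.card S - (j₀ - i₀)) * ℓ := Nat.mul_le_mul_right ℓ hK
  refine ⟨j₀ - i₀, by omega, by omega, ?_, ?_⟩
  · intro i j hi hj hij
    wlog hle : i ≤ j generalizing i j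
    · exact (this j i hj hi hij.symm (by omega)).symm
    obtain ⟨c, hc⟩ := (Nat.modEq_iff_dvd' hle).mp hij
    have : j = i + c * (ℓ * (j₀ - i₀)) := by
      rw [mul_comm c]
      omega
    rw [this, hperiod i (by omega)]
  · intro b hb i j hij
    -- Periodicity folds indices into the window from i₀ to j₀ - 1, where minimality of j₀ makes the
    -- states distinct.
    have hred : ∀ a, h ((i₀ + a) * ℓ) = h ((i₀ + a % (j₀ - i₀)) * ℓ) := by
      intro a
      rw [← hperiod ((i₀ + a % (j₀ - i₀)) * ℓ)
        (Nat.mul_le_mul_right ℓ (Nat.le_add_right _ _)) (a / (j₀ - i₀))]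
      congr 1
      conv_lhs => rw [← Nat.mod_add_div a (j₀ - i₀)]
      ring
    have hinj : ∀ a a', h ((i₀ + a) * ℓ) = h ((i₀ + a') * ℓ) → a ≡ a' [MOD j₀ - i₀] := by
      intro a a' haa
      rw [hred a, hred a'] at haa
      have h1 := Nat.mod_lt a (show 0 < j₀ - i₀ by omega)
      have h2 := Nat.mod_lt a' (show 0 < j₀ - i₀ by omega)
      by_contra hne
      rcases Nat.lt_or_gt_of_ne hne with hlt | hlt
      · exact hdistinct _ _ (by omega) (by omega) haa
      · exact hdistinct _ _ (by omega) (by omega) haa.symm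
    have hmod : b + i * ℓ ≡ b + j * ℓ [MOD ℓ] := by
      simp [Nat.ModEq]
    -- The base point `b` need not be a multiple of ℓ; running both positions forward by the same
    -- `d` brings them onto the multiples of ℓ past i₀.
    obtain ⟨c, hc⟩ : ∃ c, b ≤ (i₀ + c) * ℓ := ⟨b, by nlinarith⟩
    obtain ⟨d, hd⟩ := Nat.exists_eq_add_of_le hc
    have := hh.add_eq hmod hij d
    have h3 := hinj (c + i) (c + j) (by
      convert this using 2
      · linear_combination hd
      · linear_combination hd)
    exact Nat.ModEq.add_left_cancel' c h3

omit [Fintype S] in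
/-- If `h` has period `ℓ * n` from position `K` on, it runs through a cycle of that length. -/
theorem FollowsLoop.isLatentCycle {T : S → A → S} {â : Fin ℓ → A} {h : ℕ → S}
    (hh : FollowsLoop T â h) {n K : ℕ} (hn : 0 < n)
    (hper : ∀ i j, K ≤ i → K ≤ j → i ≡ j [MOD ℓ * n] → h i = h j) :
    IsLatentCycle T â n (fun i => h (i + ℓ * n * K)) := by
  have hℓ : 0 < ℓ := Nat.pos_of_ne_zero (NeZero.ne ℓ)
  -- The shift is a multiple of the period, which keeps phases aligned, and at least `K`, which
  -- skips the transient.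
  have hK : K ≤ ℓ * n * K := Nat.le_mul_of_pos_left K (Nat.mul_pos hℓ hn)
  refine ⟨hn, fun i _ => ?_⟩
  have hmod : i ≡ i + ℓ * n * K [MOD ℓ] := by
    simp [Nat.ModEq, mul_assoc]
  rw [fin_ofNat_eq_of_modEq hmod, ← hh]
  refine hper _ _ (by omega) (by omega) ?_
  rw [add_right_comm]
  exact (Nat.mod_modEq _ _).symm.add_right _

end Cycle

/-! ### Sample sizes and numbers of actions -/

section Counting

theorem pow_ceil_log_div_log_le {q y : ℝ} (hq0 : 0 < q) (hq1 : q < 1) (hy : 0 < y) :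
    q ^ ⌈Real.log y / Real.log q⌉₊ ≤ y := by
  have hlog : Real.log q < 0 := Real.log_neg hq0 hq1
  have h := Nat.le_ceil (Real.log y / Real.log q)
  rw [div_le_iff_of_neg hlog] at h
  rwa [← Real.log_le_log_iff (by positivity) hy, Real.log_pow]

theorem one_le_ceil_log_div_log {q y : ℝ} (hq0 : 0 < q) (hq1 : q < 1) (hy : 0 < y) (hy1 : y < 1) :
    1 ≤ ⌈Real.log y / Real.log q⌉₊ :=
  Nat.one_le_ceil_iff.mpr (div_pos_of_neg_of_neg (Real.log_neg hy hy1) (Real.log_neg hq0 hq1))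

variable {X A : Type*} [Fintype A] {P : Params X}

theorem div_card_lt_one [Nonempty A] (hδ : 0 < P.δ) (hδ' : P.δ ≤ 1) (hF : 0 < P.F.card) {c : ℝ}
    (hc : 1 ≤ c) :
    0 < P.δ / (4 * Fintype.card A * c * P.F.card) ∧
      P.δ / (4 * Fintype.card A * c * P.F.card) < 1 := by
  have hA : (1 : ℝ) ≤ Fintype.card A := by exact_mod_cast Fintype.card_pos
  have hF' : (1 : ℝ) ≤ P.F.card := by exact_mod_cast hF
  have h1 : (1 : ℝ) ≤ Fintype.card A * c := one_le_mul_of_one_le_of_one_le hA hc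
  have h2 : (1 : ℝ) ≤ Fintype.card A * c * P.F.card := one_le_mul_of_one_le_of_one_le h1 hF'
  have h3 : (4 : ℝ) ≤ 4 * Fintype.card A * c * P.F.card := by nlinarith
  refine ⟨by positivity, ?_⟩
  rw [div_lt_one (by linarith)]
  linarith

theorem one_le_pow_mul_succ (hN : 2 ≤ P.N) : (1 : ℝ) ≤ (P.N : ℝ) ^ 4 * (P.Dhat + 1) := by
  have hN' : (1 : ℝ) ≤ P.N := by exact_mod_cast (by omega : 1 ≤ P.N)
  exact one_le_mul_of_one_le_of_one_le (one_le_pow₀ hN') (by simp)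

theorem one_le_mul_sub_one (hN : 2 ≤ P.N) : (1 : ℝ) ≤ (P.N : ℝ) * (P.N - 1) := by
  have hN' : (2 : ℝ) ≤ P.N := by exact_mod_cast hN
  nlinarith

theorem one_le_nSamp [Nonempty A] (hN : 2 ≤ P.N) (hδ : 0 < P.δ) (hδ' : P.δ ≤ 1)
    (hF : 0 < P.F.card) :
    1 ≤ nSamp P A := by
  have h := div_card_lt_one (A := A) hδ hδ' hF (one_le_pow_mul_succ hN)
  rw [← mul_assoc (4 * (Fintype.card A : ℝ))] at h
  exact one_le_ceil_log_div_log (by norm_num) (by norm_num) h.1 h.2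

theorem pow_nSamp_le [Nonempty A] (hN : 2 ≤ P.N) (hδ : 0 < P.δ) (hδ' : P.δ ≤ 1)
    (hF : 0 < P.F.card) :
    (9 / 16 : ℝ) ^ nSamp P A ≤
      P.δ / (4 * Fintype.card A * (P.N : ℝ) ^ 4 * (P.Dhat + 1) * P.F.card) := by
  have h := div_card_lt_one (A := A) hδ hδ' hF (one_le_pow_mul_succ hN)
  rw [← mul_assoc (4 * (Fintype.card A : ℝ))] at h
  exact pow_ceil_log_div_log_le (by norm_num) (by norm_num) h.1

theorem one_le_nSampCyc [Nonempty A] (hN : 2 ≤ P.N) (hδ : 0 < P.δ) (hδ' : P.δ ≤ 1)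
    (hF : 0 < P.F.card) :
    1 ≤ nSampCyc P A := by
  have h := div_card_lt_one (A := A) hδ hδ' hF (one_le_mul_sub_one hN)
  rw [← mul_assoc (4 * (Fintype.card A : ℝ))] at h
  exact one_le_ceil_log_div_log (by norm_num) (by norm_num) h.1 h.2

theorem pow_nSampCyc_le [Nonempty A] (hN : 2 ≤ P.N) (hδ : 0 < P.δ) (hδ' : P.δ ≤ 1)
    (hF : 0 < P.F.card) :
    (9 / 16 : ℝ) ^ nSampCyc P A ≤
      P.δ / (4 * Fintype.card A * (P.N : ℝ) * ((P.N : ℝ) - 1) * P.F.card) := by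
  have h := div_card_lt_one (A := A) hδ hδ' hF (one_le_mul_sub_one hN)
  rw [← mul_assoc (4 * (Fintype.card A : ℝ))] at h
  exact pow_ceil_log_div_log_le (by norm_num) (by norm_num) h.1

theorem le_mul_ceilDiv {a b : ℕ} (hb : 0 < b) : a ≤ b * (a ⌈/⌉ b) :=
  le_smul_ceilDiv hb

theorem mul_ceilDiv_le {a b : ℕ} : b * (a ⌈/⌉ b) ≤ a + b - 1 := by
  rw [Nat.ceilDiv_eq_add_pred_div]
  exact Nat.mul_div_le _ _

theorem gap_mul {ℓ n : ℕ} : gap P ℓ n * ℓ = n * ℓ * (P.tmix ⌈/⌉ (n * ℓ)) := by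
  unfold gap; ring

/-- No subtraction truncates: a single copy of 2 tmix + 3Nℓ - 2 is already at least tmix + Nℓ. -/
theorem cInit_cast {ℓ : ℕ} (hN : 2 ≤ P.N) (hℓ : 0 < ℓ) (hsc : 1 ≤ nSampCyc P A) :
    (cInit P A ℓ : ℤ) = (2 * (P.tmix : ℤ) + 3 * P.N * ℓ - 2) * nSampCyc P A - P.tmix - P.N * ℓ + 1 +
      skip P ℓ := by
  have hNℓ : 2 ≤ P.N * ℓ := by nlinarith
  unfold cInit
  obtain ⟨k, hk⟩ := Nat.exists_eq_add_of_le hsc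
  rw [hk]
  generalize skip P ℓ = b
  obtain ⟨c, hc⟩ : ∃ c, 2 * P.tmix + 3 * P.N * ℓ = c + 2 :=
    ⟨2 * P.tmix + 3 * P.N * ℓ - 2, (Nat.sub_add_cancel (by nlinarith)).symm⟩
  have hc' : (2 * (P.tmix : ℤ) + 3 * P.N * ℓ - 2) = c := by
    have : ((2 * P.tmix + 3 * P.N * ℓ : ℕ) : ℤ) = c + 2 := by rw [hc]; push_cast; ring
    push_cast at this
    linarith
  rw [hc', hc, Nat.add_sub_cancel]
  have hge : P.tmix + P.N * ℓ ≤ c * (1 + k) := by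
    have : P.tmix + P.N * ℓ ≤ c := by
      have : 3 * P.N * ℓ = 3 * (P.N * ℓ) := by ring
      omega
    nlinarith
  zify [show P.tmix ≤ c * (1 + k) by omega, show P.N * ℓ ≤ c * (1 + k) - P.tmix by omega]

/-- A block consists of two gaps and nℓ steps, and a gap is at most tmix + nℓ - 1 steps, hence at
most 2 tmix + 3Nℓ - 2 in all. The last block needs no trailing gap, which pays for the amount tmix +
Nℓ - 1 subtracted in `cInit`. -/
theorem nSampCyc_le_blocks {ℓ n : ℕ} (hN : 2 ≤ P.N) (hℓ : 0 < ℓ) (hn : 0 < n) (hnN : n ≤ P.N)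
    (hsc : 1 ≤ nSampCyc P A) : nSampCyc P A ≤ blocks P A ℓ n := by
  have hc := cInit_cast hN hℓ hsc
  have hnℓ : 0 < n * ℓ := Nat.mul_pos hn hℓ
  have h1 : P.tmix ≤ gap P ℓ n * ℓ := by rw [gap_mul]; exact le_mul_ceilDiv hnℓ
  have h2 : gap P ℓ n * ℓ + 1 ≤ P.tmix + n * ℓ := by
    rw [gap_mul]
    have := mul_ceilDiv_le (a := P.tmix) (b := n * ℓ)
    omega
  unfold blocks
  have hle : n * ℓ ≤ P.N * ℓ := Nat.mul_le_mul_right ℓ hnN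
  rw [Nat.le_div_iff_mul_le (by positivity)]
  rw [show 2 * gap P ℓ n * ℓ = 2 * (gap P ℓ n * ℓ) by ring]
  generalize gap P ℓ n * ℓ = g at *
  rw [show 3 * (P.N : ℤ) * ℓ = 3 * ((P.N * ℓ : ℕ) : ℤ) by push_cast; ring,
    show (P.N : ℤ) * ℓ = ((P.N * ℓ : ℕ) : ℤ) by push_cast; ring] at hc
  generalize n * ℓ = L at *
  generalize P.N * ℓ = M at *
  obtain ⟨k, hk⟩ := Nat.exists_eq_add_of_le hsc
  rw [hk] at hc ⊢
  suffices h : (1 + k) * (2 * g + L) + skip P ℓ ≤ cInit P A ℓ + g by omega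
  zify at *
  rw [hc]
  nlinarith [mul_nonneg (show (0 : ℤ) ≤ k by positivity)
    (show 0 ≤ 2 * (P.tmix : ℤ) + 3 * M - 2 - 2 * g - L by linarith)]

/-- Rounding tmix up to a multiple of ℓn adds at most ℓn - 1. The bound `c` on the period is kept
apart from N because it will be |S|. -/
theorem steps_le {ℓ n c : ℕ} (hN : 2 ≤ P.N) (hℓ : 0 < ℓ) (hn : 0 < n) (hnc : n ≤ c)
    (hsc : 1 ≤ nSampCyc P A) (hs : 1 ≤ nSamp P A) :
    ((max (cInit P A ℓ) (cFull P A ℓ n) : ℕ) : ℤ) ≤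
      max ((2 * (P.tmix : ℤ) + 3 * P.N * ℓ - 2) * nSampCyc P A - (P.N : ℤ) * ℓ)
        (2 * ((P.tmix : ℤ) + c * ℓ - 1) * nSamp P A + 1) +
      max ((P.N : ℤ) * ℓ - ℓ - P.tmix) 0 + 1 := by
  have hc := cInit_cast hN hℓ hsc
  have hskip : (skip P ℓ : ℤ) = P.tmix + max ((P.N : ℤ) * ℓ - ℓ - P.tmix) 0 := by
    unfold skip
    have : (((P.N - 1) * ℓ : ℕ) : ℤ) = (P.N : ℤ) * ℓ - ℓ := by
      zify [show 1 ≤ P.N by omega]; ring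
    rw [Nat.cast_max, this]
    omega
  rw [Nat.cast_max]
  refine max_le ?_ ?_
  · rw [hc, hskip]
    have := le_max_left ((2 * (P.tmix : ℤ) + 3 * P.N * ℓ - 2) * nSampCyc P A - (P.N : ℤ) * ℓ)
      (2 * ((P.tmix : ℤ) + c * ℓ - 1) * nSamp P A + 1)
    linarith
  · have h2 : ℓ * n * (P.tmix ⌈/⌉ (ℓ * n)) + 1 ≤ P.tmix + ℓ * n := by
      have := mul_ceilDiv_le (a := P.tmix) (b := ℓ * n)
      have := Nat.mul_pos hℓ hn
      omega
    have h3 : (((P.N - n) * ℓ : ℕ) : ℤ) ≤ max ((P.N : ℤ) * ℓ - ℓ) 0 := by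
      refine le_trans ?_ (le_max_left _ _)
      have : (P.N - n) * ℓ ≤ (P.N - 1) * ℓ := Nat.mul_le_mul_right _ (by omega)
      have h4 : (((P.N - 1) * ℓ : ℕ) : ℤ) = (P.N : ℤ) * ℓ - ℓ := by
        zify [show 1 ≤ P.N by omega]; ring
      rw [← h4]
      exact_mod_cast this
    have h5 : (max ((P.N - n) * ℓ) P.tmix : ℕ) ≤ P.tmix + max ((P.N : ℤ) * ℓ - ℓ - P.tmix) 0 := by
      rw [Nat.cast_max]
      have h6 : (0 : ℤ) ≤ (P.N : ℤ) * ℓ - ℓ := by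
        have : (1 : ℤ) ≤ P.N := by exact_mod_cast (by omega : 1 ≤ P.N)
        nlinarith [show (0 : ℤ) ≤ ℓ by positivity]
      omega
    have h7 : (ℓ * n : ℤ) ≤ c * ℓ := by
      have : ℓ * n ≤ c * ℓ := by rw [mul_comm]; exact Nat.mul_le_mul_right ℓ hnc
      exact_mod_cast this
    unfold cFull
    obtain ⟨k, hk⟩ := Nat.exists_eq_add_of_le hs
    rw [hk, Nat.add_sub_cancel_left]
    generalize (P.tmix ⌈/⌉ (ℓ * n)) = q at *
    have h8 := le_max_right ((2 * (P.tmix : ℤ) + 3 * P.N * ℓ - 2) * nSampCyc P A - (P.N : ℤ) * ℓ)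
      (2 * ((P.tmix : ℤ) + c * ℓ - 1) * (1 + k : ℕ) + 1)
    zify at h2
    push_cast at h5 h8 ⊢
    have h9 : (2 * n * ℓ * (k * q + 1) : ℤ) ≤ 2 * k * (P.tmix + c * ℓ - 1) + 2 * (c * ℓ) := by
      have : (k : ℤ) * (ℓ * n * q) ≤ k * (P.tmix + c * ℓ - 1) :=
        mul_le_mul_of_nonneg_left (by linarith) (by positivity)
      nlinarith
    nlinarith

end Counting

/-! ### Sample times of the new datasets -/

section NewTimes

variable {X A : Type*} [Fintype A] {P : Params X} {ℓ n : ℕ}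

/-- The part of the dataset number `i` that is collected with offset `o`. -/
noncomputable def newTimesAt (P : Params X) (A : Type*) [Fintype A] (ℓ t₀ n i o : ℕ) : Finset ℕ :=
  (Finset.range (nSamp P A)).image fun k =>
    t₀ + (k * (ℓ * n * (P.tmix ⌈/⌉ (ℓ * n))) + o + (((i : ℤ) - (o : ℤ)) % ((ℓ * n : ℕ) : ℤ)).toNat)

theorem newTimes_eq_union (t₀ i : ℕ) :
    newTimes P A ℓ t₀ n i =
      newTimesAt P A ℓ t₀ n i (offA P ℓ n) ∪ newTimesAt P A ℓ t₀ n i (offB P A ℓ n) := by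
  ext t
  simp only [newTimes, newTimesAt, Finset.mem_image, Finset.mem_union, Finset.mem_product,
    Finset.mem_insert, Finset.mem_singleton, Prod.exists]
  constructor
  · rintro ⟨k, o, ⟨hk, rfl | rfl⟩, h⟩
    · exact Or.inl ⟨k, hk, h⟩
    · exact Or.inr ⟨k, hk, h⟩
  · rintro (⟨k, hk, h⟩ | ⟨k, hk, h⟩)
    · exact ⟨k, _, ⟨hk, Or.inl rfl⟩, h⟩
    · exact ⟨k, _, ⟨hk, Or.inr rfl⟩, h⟩

theorem toNat_sub_emod_spec {L : ℕ} (hL : 0 < L) (i o : ℕ) :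
    (((i : ℤ) - (o : ℤ)) % (L : ℤ)).toNat < L ∧
      o + (((i : ℤ) - (o : ℤ)) % (L : ℤ)).toNat ≡ i [MOD L] := by
  have hL' : (0 : ℤ) < L := by exact_mod_cast hL
  have h0 := Int.emod_nonneg ((i : ℤ) - o) hL'.ne'
  have h1 := Int.emod_lt_of_pos ((i : ℤ) - o) hL'
  refine ⟨by omega, ?_⟩
  rw [← Int.natCast_modEq_iff]
  rw [Nat.cast_add, Int.toNat_of_nonneg h0]
  calc (o : ℤ) + ((i : ℤ) - o) % L ≡ o + (i - o) [ZMOD L] := (Int.mod_modEq _ _).add_left _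
    _ = i := by ring

theorem mem_newTimesAt (hL : 0 < ℓ * n) {t₀ i o t : ℕ} (ht : t ∈ newTimesAt P A ℓ t₀ n i o) :
    t₀ + o ≤ t ∧
      t < t₀ + o + (nSamp P A - 1) * (ℓ * n * (P.tmix ⌈/⌉ (ℓ * n))) + ℓ * n ∧
      ∃ j, t = t₀ + j ∧ o ≤ j ∧ j ≡ i [MOD ℓ * n] := by
  simp only [newTimesAt, Finset.mem_image, Finset.mem_range] at ht
  obtain ⟨k, hk, rfl⟩ := ht
  obtain ⟨h1, h2⟩ := toNat_sub_emod_spec hL i o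
  have hk' : k * (ℓ * n * (P.tmix ⌈/⌉ (ℓ * n))) ≤
      (nSamp P A - 1) * (ℓ * n * (P.tmix ⌈/⌉ (ℓ * n))) :=
    Nat.mul_le_mul_right _ (by omega)
  refine ⟨by omega, by omega, _, rfl, by omega, ?_⟩
  have h3 : k * (ℓ * n * (P.tmix ⌈/⌉ (ℓ * n))) ≡ 0 [MOD ℓ * n] :=
    (Nat.modEq_zero_iff_dvd).mpr ((dvd_mul_right _ _).mul_left k)
  simpa [add_assoc] using h3.add h2

/-- For fixed position and offset the remainder is constant, so times differ by multiples of a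
number that is at least tmix. -/
theorem spaced_newTimesAt (hL : 0 < ℓ * n) (t₀ i o : ℕ) :
    Spaced P.tmix (newTimesAt P A ℓ t₀ n i o) := by
  intro s hs t ht hst
  simp only [newTimesAt, Finset.mem_image, Finset.mem_range] at hs ht
  obtain ⟨k, hk, rfl⟩ := hs
  obtain ⟨k', hk', rfl⟩ := ht
  have hR := le_mul_ceilDiv (a := P.tmix) hL
  generalize ℓ * n * (P.tmix ⌈/⌉ (ℓ * n)) = R at *
  have hkk : k * R < k' * R := by omega
  have hlt : k < k' := Nat.lt_of_mul_lt_mul_right hkk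
  have := Nat.mul_le_mul_right R hlt
  rw [Nat.succ_mul] at this
  omega

theorem card_newTimesAt (h1 : 1 ≤ P.tmix) (hL : 0 < ℓ * n) (t₀ i o : ℕ) :
    (newTimesAt P A ℓ t₀ n i o).card = nSamp P A := by
  unfold newTimesAt
  have hR := le_mul_ceilDiv (a := P.tmix) hL
  rw [Finset.card_image_of_injective, Finset.card_range]
  intro k k' hkk
  simp only at hkk
  exact Nat.eq_of_mul_eq_mul_right (by omega : 0 < ℓ * n * (P.tmix ⌈/⌉ (ℓ * n))) (by omega)

theorem Spaced.union {t : ℕ} {τ τ' : Finset ℕ} (h : Spaced t τ) (h' : Spaced t τ')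
    (hlt : ∀ i ∈ τ, ∀ j ∈ τ', i + t ≤ j) : Spaced t (τ ∪ τ') := by
  intro i hi j hj hij
  rcases Finset.mem_union.mp hi with hi | hi <;> rcases Finset.mem_union.mp hj with hj | hj
  · exact h i hi j hj hij
  · exact hlt i hi j hj
  · have := hlt j hj i hi
    omega
  · exact h' i hi j hj hij

theorem Spaced.mono {t : ℕ} {τ τ' : Finset ℕ} (h : Spaced t τ) (hsub : τ' ⊆ τ) : Spaced t τ' :=
  fun i hi j hj => h i (hsub hi) j (hsub hj)

/-- The two positions may differ. Datasets collected concurrently interleave, but the first half of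
one always precedes the second half of another by tmix, which makes them comparable. -/
theorem offA_half_add_le (hL : 0 < ℓ * n) {t₀ i i' s t : ℕ}
    (hs : s ∈ newTimesAt P A ℓ t₀ n i (offA P ℓ n))
    (ht : t ∈ newTimesAt P A ℓ t₀ n i' (offB P A ℓ n)) : s + P.tmix ≤ t := by
  have h1 := (mem_newTimesAt hL hs).2.1
  have h2 := (mem_newTimesAt hL ht).1
  unfold offB at h2
  omega

theorem spaced_newTimes (hL : 0 < ℓ * n) (t₀ i : ℕ) : Spaced P.tmix (newTimes P A ℓ t₀ n i) := by
  rw [newTimes_eq_union]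
  exact (spaced_newTimesAt hL _ _ _).union (spaced_newTimesAt hL _ _ _)
    fun _ hs _ ht => offA_half_add_le hL hs ht

theorem nSamp_le_card_newTimes (h1 : 1 ≤ P.tmix) (hL : 0 < ℓ * n) (t₀ i : ℕ) :
    nSamp P A ≤ (newTimes P A ℓ t₀ n i).card := by
  rw [newTimes_eq_union, ← card_newTimesAt (A := A) h1 hL t₀ i (offA P ℓ n)]
  exact Finset.card_le_card Finset.subset_union_left

theorem mem_newTimes (hL : 0 < ℓ * n) {t₀ i t : ℕ} (ht : t ∈ newTimes P A ℓ t₀ n i) :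
    t ≤ t₀ + cFull P A ℓ n ∧ ∃ j, t = t₀ + j ∧ offA P ℓ n ≤ j ∧ j ≡ i [MOD ℓ * n] := by
  rw [newTimes_eq_union, Finset.mem_union] at ht
  have hoff : offA P ℓ n ≤ offB P A ℓ n := by unfold offB; omega
  have hc : cFull P A ℓ n = offB P A ℓ n +
      (nSamp P A - 1) * (ℓ * n * (P.tmix ⌈/⌉ (ℓ * n))) + ℓ * n := by
    unfold cFull offB offA; ring
  rcases ht with ht | ht
  · obtain ⟨h1, h2, j, h3, h4, h5⟩ := mem_newTimesAt hL ht
    exact ⟨by omega, j, h3, h4, h5⟩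
  · obtain ⟨h1, h2, j, h3, h4, h5⟩ := mem_newTimesAt hL ht
    exact ⟨by omega, j, h3, by omega, h5⟩

end NewTimes

/-! ### Deterministic behaviour of the algorithm off the bad events -/

section Run

variable {X S A : Type*} {P : Params X} {φ : X → S} {lat : ℕ → S} {T : S → A → S}

theorem test_eq_true (horacle : IsTrainingOracle P.F P.oracle)
    (hreal : ∀ s : S, ∃ f ∈ P.F, ∀ x, f x = true ↔ φ x = s) {x : ℕ → X}
    (hx : ∀ t, φ (x t) = lat t) {τ₀ τ₁ : Finset ℕ} {v : S} (h₀ : ∀ t ∈ τ₀, lat t ≠ v)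
    (h₁ : ∀ t ∈ τ₁, lat t = v) : test P x τ₀ τ₁ = true := by
  obtain ⟨f, hf, hfv⟩ := hreal v
  rw [test, decide_eq_true_eq]
  refine (horacle _ _).2 ⟨f, hf, separates_sample_iff.mpr ⟨fun t ht => ?_, fun t ht => ?_⟩⟩
  · rw [← Bool.not_eq_true, hfv, hx]
    exact h₀ t ht
  · rw [hfv, hx]
    exact h₁ t ht

/-- The oracle chooses its classifier after seeing the data, so all members of the class are
excluded at once. -/
theorem test_eq_false (horacle : IsTrainingOracle P.F P.oracle) {x : ℕ → X} {τ₀ τ₁ : Finset ℕ}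
    (h : ∀ f ∈ P.F, ¬ Separates f (sample x τ₀) (sample x τ₁)) : test P x τ₀ τ₁ = false := by
  rw [test, decide_eq_false_iff_not]
  exact h _ (horacle _ _).1

/-- The search descends, so candidates below `n` are never consulted; the value 1 is the default and
needs no successful test. -/
theorem findPeriod_eq [Fintype A] {ℓ t₀ n M : ℕ} {x : ℕ → X} (hn : 0 < n) (hnM : n ≤ M)
    (hgt : ∀ n', n < n' → n' ≤ M →
      test P x (times₀ P A ℓ t₀ n') (times₁ P A ℓ t₀ n') = false)
    (heq : 2 ≤ n → test P x (times₀ P A ℓ t₀ n) (times₁ P A ℓ t₀ n) = true) :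
    findPeriod P A ℓ t₀ x M = n := by
  induction M with
  | zero => omega
  | succ M ih =>
    cases M with
    | zero => rw [findPeriod]; omega
    | succ M =>
      rw [findPeriod]
      rcases hnM.eq_or_lt with rfl | hlt
      · rw [if_pos (heq (by omega))]
      · rw [if_neg (by rw [hgt _ hlt le_rfl]; simp)]
        exact ih (by omega) fun n' h h' => hgt n' h (by omega)

theorem notMem_sum_add_one (l : List ℕ) : l.sum + 1 ∉ l := fun h => by
  have := List.single_le_sum (fun _ _ => Nat.zero_le _) _ h
  omega

theorem Consistent.weaken {now now' nsamp tmix : ℕ} {m : PartialModel A} {σ : ℕ → S}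
    (h : Consistent T lat now nsamp tmix m σ) (hle : now ≤ now') :
    Consistent T lat now' nsamp tmix m σ :=
  { h with past := fun s hs t ht => (h.past s hs t ht).trans hle }

variable {ℓ n t₀ now nsamp : ℕ} {m : PartialModel A} {σ : ℕ → S}

/-- The deterministic result of identifying a position of the cycle whose state is `v`. The sets
`base u` are parts of the datasets that suffice to recognize the state `u`. -/
theorem Consistent.exists_identify [Fintype A] (hm : Consistent T lat now nsamp P.tmix m σ)
    (horacle : IsTrainingOracle P.F P.oracle)
    (hreal : ∀ s : S, ∃ f ∈ P.F, ∀ x, f x = true ↔ φ x = s) {i : ℕ} {v : S}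
    (hlat : ∀ t ∈ newTimes P A ℓ t₀ n i, lat t = v)
    (hcard : nsamp ≤ (newTimes P A ℓ t₀ n i).card)
    (hspaced : Spaced P.tmix (newTimes P A ℓ t₀ n i))
    (hpast : ∀ t ∈ newTimes P A ℓ t₀ n i, t ≤ now) {base : S → Finset ℕ}
    (hbase : ∀ s ∈ m.states, base (σ s) ⊆ m.data s)
    (hv : (∀ s ∈ m.states, σ s ≠ v) → base v ⊆ newTimes P A ℓ t₀ n i) :
    ∃ (m' : PartialModel A) (s' : ℕ) (σ' : ℕ → S),
      Consistent T lat now nsamp P.tmix m' σ' ∧ s' ∈ m'.states ∧ σ' s' = v ∧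
      (∀ s ∈ m'.states, base (σ' s) ⊆ m'.data s) ∧
      (∀ s ∈ m.states, s ∈ m'.states ∧ σ' s = σ s ∧ m'.trans s = m.trans s) ∧
      ∀ x : ℕ → X, (∀ t, φ (x t) = lat t) →
        (∀ f ∈ P.F, ¬ Separates f (sample x (base v)) (sample x (newTimes P A ℓ t₀ n i))) →
        identify P ℓ t₀ x n m i = (m', s') := by
  by_cases hex : ∃ s ∈ m.states, σ s = v
  · obtain ⟨s₀, hs₀, rfl⟩ := hex
    -- The indicator of the state separates the new data from every other known dataset, while
    -- non-separation passes from `base` to the possibly larger dataset of s₀.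
    have hfind : ∀ x : ℕ → X, (∀ t, φ (x t) = lat t) →
        (∀ f ∈ P.F, ¬ Separates f (sample x (base (σ s₀)))
          (sample x (newTimes P A ℓ t₀ n i))) →
        m.states.find? (fun s => !test P x (m.data s) (newTimes P A ℓ t₀ n i)) = some s₀ := by
      intro x hx hsep
      have htest : ∀ s ∈ m.states, (!test P x (m.data s) (newTimes P A ℓ t₀ n i)) = true ↔
          s = s₀ := by
        intro s hs
        constructor
        · intro h
          by_contra hne
          rw [test_eq_true horacle hreal hx (v := σ s₀) (fun t ht => ?_) hlat] at h
          · simp at h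
          · rw [hm.label s hs t ht]
            exact fun heq => hne (hm.inj s hs s₀ hs₀ heq)
        · rintro rfl
          rw [test_eq_false horacle fun f hf hf' =>
            hsep f hf (hf'.mono (hbase s hs) subset_rfl)]
          rfl
      cases hf : m.states.find? (fun s => !test P x (m.data s) (newTimes P A ℓ t₀ n i)) with
      | none =>
        rw [List.find?_eq_none] at hf
        exact absurd ((htest s₀ hs₀).mpr rfl) (hf s₀ hs₀)
      | some s =>
        exact congrArg some ((htest s (List.mem_of_find?_eq_some hf)).mp
          (by simpa using List.find?_some hf))
    by_cases hmerge : P.merge i s₀ = true ∧ Spaced P.tmix (m.data s₀ ∪ newTimes P A ℓ t₀ n i)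
    · refine ⟨{ m with data := Function.update m.data s₀ (m.data s₀ ∪ newTimes P A ℓ t₀ n i) },
        s₀, σ, ?_, hs₀, rfl, ?_, ?_, ?_⟩
      · refine ⟨hm.nodup, hm.inj, hm.trans, ?_, ?_, ?_, ?_⟩
        · intro s hs t ht
          rcases eq_or_ne s s₀ with rfl | hne
          · simp only [Function.update_self, Finset.mem_union] at ht
            exact ht.elim (hm.label s hs t) (hlat t)
          · simp only [Function.update_of_ne hne] at ht
            exact hm.label s hs t ht
        · intro s hs
          rcases eq_or_ne s s₀ with rfl | hne
          · simp only [Function.update_self]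
            exact (hm.card s hs).trans (Finset.card_le_card Finset.subset_union_left)
          · simp only [Function.update_of_ne hne]
            exact hm.card s hs
        · intro s hs
          rcases eq_or_ne s s₀ with rfl | hne
          · simp only [Function.update_self]
            exact hmerge.2
          · simp only [Function.update_of_ne hne]
            exact hm.spaced s hs
        · intro s hs t ht
          rcases eq_or_ne s s₀ with rfl | hne
          · simp only [Function.update_self, Finset.mem_union] at ht
            exact ht.elim (hm.past s hs t) (hpast t)
          · simp only [Function.update_of_ne hne] at ht
            exact hm.past s hs t ht
      · intro s hs
        rcases eq_or_ne s s₀ with rfl | hne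
        · simp only [Function.update_self]
          exact (hbase s hs).trans Finset.subset_union_left
        · simp only [Function.update_of_ne hne]
          exact hbase s hs
      · exact fun s hs => ⟨hs, rfl, rfl⟩
      · intro x hx hsep
        rw [identify, hfind x hx hsep]
        simp only [if_pos hmerge]
    · refine ⟨m, s₀, σ, hm, hs₀, rfl, hbase, fun s hs => ⟨hs, rfl, rfl⟩, fun x hx hsep => ?_⟩
      rw [identify, hfind x hx hsep]
      simp only [if_neg hmerge]
  · push Not at hex
    have hfind : ∀ x : ℕ → X, (∀ t, φ (x t) = lat t) →
        m.states.find? (fun s => !test P x (m.data s) (newTimes P A ℓ t₀ n i)) = none := by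
      intro x hx
      rw [List.find?_eq_none]
      intro s hs
      rw [test_eq_true horacle hreal hx (v := v) (fun t ht => ?_) hlat]
      · simp
      · rw [hm.label s hs t ht]
        exact hex s hs
    have hfresh := notMem_sum_add_one m.states
    set s' := m.states.sum + 1 with hs'
    have hne : ∀ s ∈ m.states, s ≠ s' := fun s hs h => hfresh (h ▸ hs)
    refine ⟨{ states := m.states ++ [s']
              trans := Function.update m.trans s' fun _ => none
              data := Function.update m.data s' (newTimes P A ℓ t₀ n i) }, s',
      Function.update σ s' v, ?_, by simp, by simp, ?_, ?_, ?_⟩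
    · refine ⟨?_, ?_, ?_, ?_, ?_, ?_, ?_⟩
      · simpa [List.nodup_append, hm.nodup] using hne
      · intro s hs u hu h
        simp only [List.mem_append, List.mem_singleton] at hs hu
        rcases hs with hs | rfl <;> rcases hu with hu | rfl
        · rw [Function.update_of_ne (hne s hs), Function.update_of_ne (hne u hu)] at h
          exact hm.inj s hs u hu h
        · rw [Function.update_of_ne (hne s hs), Function.update_self] at h
          exact absurd h (hex s hs)
        · rw [Function.update_of_ne (hne u hu), Function.update_self] at h
          exact absurd h.symm (hex u hu)
        · rfl
      · intro s hs a u h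
        simp only [List.mem_append, List.mem_singleton] at hs ⊢
        rcases hs with hs | rfl
        · simp only [Function.update_of_ne (hne s hs)] at h ⊢
          obtain ⟨h1, h2⟩ := hm.trans s hs a u h
          exact ⟨Or.inl h1, by rw [Function.update_of_ne (hne u h1), h2]⟩
        · simp at h
      · intro s hs t ht
        simp only [List.mem_append, List.mem_singleton] at hs
        rcases hs with hs | rfl
        · simp only [Function.update_of_ne (hne s hs)] at ht ⊢
          exact hm.label s hs t ht
        · simp only [Function.update_self] at ht ⊢
          exact hlat t ht
      · intro s hs
        simp only [List.mem_append, List.mem_singleton] at hs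
        rcases hs with hs | rfl
        · simp only [Function.update_of_ne (hne s hs)]
          exact hm.card s hs
        · simpa only [Function.update_self] using hcard
      · intro s hs
        simp only [List.mem_append, List.mem_singleton] at hs
        rcases hs with hs | rfl
        · simp only [Function.update_of_ne (hne s hs)]
          exact hm.spaced s hs
        · simpa only [Function.update_self] using hspaced
      · intro s hs t ht
        simp only [List.mem_append, List.mem_singleton] at hs
        rcases hs with hs | rfl
        · simp only [Function.update_of_ne (hne s hs)] at ht
          exact hm.past s hs t ht
        · simp only [Function.update_self] at ht
          exact hpast t ht
    · intro s hs
      simp only [List.mem_append, List.mem_singleton] at hs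
      rcases hs with hs | rfl
      · simp only [Function.update_of_ne (hne s hs)]
        exact hbase s hs
      · simp only [Function.update_self]
        exact hv hex
    · intro s hs
      exact ⟨List.mem_append_left _ hs, by rw [Function.update_of_ne (hne s hs)],
        by simp only [Function.update_of_ne (hne s hs)]⟩
    · intro x hx _
      rw [identify, hfind x hx]

/-- The deterministic result of identifying the first `k` positions of the cycle. -/
theorem Consistent.exists_identifyAll [Fintype A] (hm : Consistent T lat now nsamp P.tmix m σ)
    (horacle : IsTrainingOracle P.F P.oracle)
    (hreal : ∀ s : S, ∃ f ∈ P.F, ∀ x, f x = true ↔ φ x = s) {cyc : ℕ → S} {k : ℕ}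
    (hlat : ∀ i < k, ∀ t ∈ newTimes P A ℓ t₀ n i, lat t = cyc i)
    (hcard : ∀ i < k, nsamp ≤ (newTimes P A ℓ t₀ n i).card)
    (hspaced : ∀ i < k, Spaced P.tmix (newTimes P A ℓ t₀ n i))
    (hpast : ∀ i < k, ∀ t ∈ newTimes P A ℓ t₀ n i, t ≤ now) {base : S → Finset ℕ}
    (hbase : ∀ s ∈ m.states, base (σ s) ⊆ m.data s)
    (hfirst : ∀ i < k, (∀ s ∈ m.states, σ s ≠ cyc i) → (∀ j < i, cyc j ≠ cyc i) →
      base (cyc i) ⊆ newTimes P A ℓ t₀ n i) :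
    ∃ (m' : PartialModel A) (lab : ℕ → ℕ) (σ' : ℕ → S),
      Consistent T lat now nsamp P.tmix m' σ' ∧
      (∀ i < k, lab i ∈ m'.states ∧ σ' (lab i) = cyc i) ∧
      (∀ s ∈ m'.states, base (σ' s) ⊆ m'.data s) ∧
      (∀ s ∈ m.states, s ∈ m'.states ∧ σ' s = σ s ∧ m'.trans s = m.trans s) ∧
      ∀ x : ℕ → X, (∀ t, φ (x t) = lat t) →
        (∀ i < k, ∀ f ∈ P.F,
          ¬ Separates f (sample x (base (cyc i))) (sample x (newTimes P A ℓ t₀ n i))) →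
        identifyAll P ℓ t₀ x n m k = (m', lab) := by
  induction k with
  | zero =>
    exact ⟨m, fun _ => 0, σ, hm, by simp, hbase, fun s hs => ⟨hs, rfl, rfl⟩, fun x _ _ => rfl⟩
  | succ k ih =>
    obtain ⟨m₁, lab, σ₁, hm₁, hlab, hbase₁, hext, hrun⟩ := ih (fun i hi => hlat i (by omega))
      (fun i hi => hcard i (by omega)) (fun i hi => hspaced i (by omega))
      (fun i hi => hpast i (by omega)) (fun i hi => hfirst i (by omega))
    -- If no label of the current model stands for `cyc k`, this state was neither known at the
    -- start nor met at an earlier position, so `hfirst` applies.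
    obtain ⟨m₂, s₂, σ₂, hm₂, hs₂, hσ₂, hbase₂, hext₂, hrun₂⟩ :=
      hm₁.exists_identify horacle hreal (hlat k (by omega)) (hcard k (by omega))
        (hspaced k (by omega)) (hpast k (by omega)) hbase₁ fun hne =>
        hfirst k (by omega)
          (fun s hs => by rw [← (hext s hs).2.1]; exact hne s (hext s hs).1)
          fun j hj => by rw [← (hlab j hj).2]; exact hne _ (hlab j hj).1
    refine ⟨m₂, Function.update lab k s₂, σ₂, hm₂, ?_, hbase₂, ?_, ?_⟩
    · intro i hi
      rcases eq_or_ne i k with rfl | hne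
      · rw [Function.update_self]
        exact ⟨hs₂, hσ₂⟩
      · have hik := hlab i (by omega)
        have hik₂ := hext₂ _ hik.1
        rw [Function.update_of_ne hne]
        exact ⟨hik₂.1, hik₂.2.1.trans hik.2⟩
    · intro s hs
      have h₁ := hext s hs
      have h₂ := hext₂ s h₁.1
      exact ⟨h₂.1, h₂.2.1.trans h₁.2.1, h₂.2.2.trans h₁.2.2⟩
    · intro x hx hsep
      have h₁ := hrun x hx fun i hi => hsep i (by omega)
      have h₂ := hrun₂ x hx (hsep k (by omega))
      simp only [identifyAll, h₁, h₂]

/-- Adding the transitions of a cycle of true states keeps the model correct. -/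
theorem Consistent.addTrans [DecidableEq A] [NeZero ℓ] {â : Fin ℓ → A}
    (hm : Consistent T lat now nsamp P.tmix m σ) {cyc : ℕ → S} (hcyc : IsLatentCycle T â n cyc)
    {lab : ℕ → ℕ} (hlab : ∀ i < ℓ * n, lab i ∈ m.states ∧ σ (lab i) = cyc i) {k : ℕ}
    (hk : k ≤ ℓ * n) :
    Consistent T lat now nsamp P.tmix { m with trans := addTrans â n lab m.trans k } σ ∧
      (∀ s ∈ m.states, ∀ a s', m.trans s a = some s' →
        STEEL.addTrans â n lab m.trans k s a = some s') ∧
      ∀ i < k, STEEL.addTrans â n lab m.trans k (lab i) (â (Fin.ofNat ℓ i)) =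
        some (lab ((i + 1) % (ℓ * n))) := by
  have hL : 0 < ℓ * n := Nat.mul_pos (Nat.pos_of_ne_zero (NeZero.ne ℓ)) hcyc.1
  induction k with
  | zero => exact ⟨hm, fun _ _ _ _ h => h, by simp⟩
  | succ k ih =>
    obtain ⟨h1, h2, h3⟩ := ih (by omega)
    have hkL : k < ℓ * n := by omega
    have hnext := hlab _ (Nat.mod_lt (k + 1) hL)
    have hval : σ (lab ((k + 1) % (ℓ * n))) = T (σ (lab k)) (â (Fin.ofNat ℓ k)) := by
      rw [hnext.2, (hlab k hkL).2, hcyc.2 k hkL]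
    have happ : ∀ s a, STEEL.addTrans â n lab m.trans (k + 1) s a =
        if s = lab k ∧ a = â (Fin.ofNat ℓ k) then some (lab ((k + 1) % (ℓ * n)))
        else STEEL.addTrans â n lab m.trans k s a := by
      intro s a
      rw [STEEL.addTrans]
      rcases eq_or_ne s (lab k) with rfl | hs
      · rcases eq_or_ne a (â (Fin.ofNat ℓ k)) with rfl | ha
        · simp
        · rw [Function.update_self, Function.update_of_ne ha, if_neg fun h => ha h.2]
      · rw [Function.update_of_ne hs, if_neg fun h => hs h.1]
    have hkeep : ∀ s ∈ m.states, ∀ a s', STEEL.addTrans â n lab m.trans k s a = some s' →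
        STEEL.addTrans â n lab m.trans (k + 1) s a = some s' := by
      intro s hs a s' h
      rw [happ]
      split_ifs with hif
      · obtain ⟨rfl, rfl⟩ := hif
        -- Overwriting is harmless: the old and new targets stand for the same true state, so they
        -- coincide by injectivity.
        have h4 := h1.trans (lab k) hs _ s' h
        exact congrArg some (hm.inj _ hnext.1 s' h4.1 (hval.trans h4.2.symm))
      · exact h
    refine ⟨{ h1 with trans := ?_ }, fun s hs a s' h => hkeep s hs a s' (h2 s hs a s' h), ?_⟩
    · intro s hs a s' h
      simp only [happ] at h
      split_ifs at h with hif
      · obtain ⟨rfl, rfl⟩ := hif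
        obtain rfl := Option.some.inj h
        exact ⟨hnext.1, hval⟩
      · exact h1.trans s hs a s' h
    · intro i hi
      rcases eq_or_ne i k with rfl | hne
      · rw [happ, if_pos ⟨rfl, rfl⟩]
      · exact hkeep _ (hlab i (by omega)).1 _ _ (h3 i (by omega))

end Run

theorem followsLoop_latentSeq {S A : Type*} {ℓ : ℕ} [NeZero ℓ] (T : S → A → S) (s : S)
    (past : List A) (â : Fin ℓ → A) :
    FollowsLoop T â fun j => latentSeq T s (actionSeq past â) (past.length + j) := by
  intro j
  simp only [latentSeq]
  congr 1
  simp [actionSeq]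

/-! ### Correctness of the tests -/

section PeriodTest

variable {X S A : Type*} [Fintype A] {P : Params X} {φ : X → S} {lat h : ℕ → S} {ℓ n K t₀ : ℕ}

theorem test_period_eq_true (horacle : IsTrainingOracle P.F P.oracle)
    (hreal : ∀ s : S, ∃ f ∈ P.F, ∀ x, f x = true ↔ φ x = s) {x : ℕ → X}
    (hx : ∀ t, φ (x t) = lat t) (hlat : ∀ j, lat (t₀ + j) = h j) (hK : K ≤ skip P ℓ)
    (hper : ∀ i j, K ≤ i → K ≤ j → i ≡ j [MOD ℓ * n] → h i = h j)
    (hdist : ∀ b, K ≤ b → ∀ i j, h (b + i * ℓ) = h (b + j * ℓ) → i ≡ j [MOD n]) :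
    test P x (times₀ P A ℓ t₀ n) (times₁ P A ℓ t₀ n) = true := by
  -- Modulo `n`, the second dataset therefore uses index 0 only and the first one the indices 1, …,
  -- n - 1.
  have hgap : n ∣ gap P ℓ n := dvd_mul_left _ _
  refine test_eq_true horacle hreal hx (v := h (skip P ℓ)) ?_ ?_
  · intro t ht
    simp only [times₀, Finset.mem_image, Finset.mem_product, Finset.mem_Icc, Prod.exists] at ht
    obtain ⟨i, j, ⟨-, hj1, hj2⟩, rfl⟩ := ht
    rw [barTime, hlat, add_comm]
    intro heq
    have hmod := hdist (skip P ℓ) hK _ 0 (heq.trans (by rw [zero_mul, add_zero]))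
    have hdvd := (Nat.modEq_zero_iff_dvd).mp hmod
    have h1 : n ∣ gap P ℓ n + (2 * gap P ℓ n + n) * i :=
      hgap.add (((hgap.mul_left 2).add (dvd_refl n)).mul_right i)
    have h2 := Nat.le_of_dvd (by omega) ((Nat.dvd_add_right h1).mp hdvd)
    omega
  · intro t ht
    simp only [times₁, Finset.mem_image] at ht
    obtain ⟨i, -, rfl⟩ := ht
    rw [barTime, hlat]
    refine hper _ _ (by omega) hK ?_
    have h1 : n ∣ (2 * gap P ℓ n + n) * i := ((hgap.mul_left 2).add (dvd_refl n)).mul_right i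
    have h2 : (2 * gap P ℓ n + n) * i * ℓ ≡ 0 [MOD ℓ * n] :=
      Nat.modEq_zero_iff_dvd.mpr (by rw [mul_comm _ ℓ]; exact mul_dvd_mul_left ℓ h1)
    simpa using h2.add_right (skip P ℓ)

variable {E : Type*} [MeasurableSpace E] [MeasurableSpace X]
  {Q : S → Kernel E X} [∀ s, IsMarkovKernel (Q s)] {Te : Kernel E E} [IsMarkovKernel Te]
  {init π : Measure E} [IsProbabilityMeasure init] [IsProbabilityMeasure π]

/-- A candidate that exceeds the true period is unlikely to pass the test. -/
theorem measureReal_separates_period_le (h1 : 1 ≤ P.tmix)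
    (hmix : mixingTime Te π (1 / 4) ≤ (P.tmix : ℕ∞)) (hN : 2 ≤ P.N)
    (hsc : 1 ≤ nSampCyc P A) (hℓ : 0 < ℓ) (hn : 0 < n) {n' : ℕ} (hlt : n < n') (hle : n' ≤ P.N)
    (hlat : ∀ j, lat (t₀ + j) = h j) (hK : K ≤ skip P ℓ)
    (hper : ∀ i j, K ≤ i → K ≤ j → i ≡ j [MOD ℓ * n] → h i = h j) {f : X → Bool}
    (hf : Measurable f) :
    (trajLaw Q Te init lat).real {w | Separates f
        (sample (fun t => (w t).2) (times₀ P A ℓ t₀ n'))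
        (sample (fun t => (w t).2) (times₁ P A ℓ t₀ n'))} ≤ (9 / 16) ^ nSampCyc P A := by
  have hblocks := nSampCyc_le_blocks (A := A) (n := n') hN hℓ (by omega) hle hsc
  have hr : P.tmix ≤ gap P ℓ n' * ℓ := by
    rw [gap_mul]
    exact le_mul_ceilDiv (Nat.mul_pos (by omega) hℓ)
  set r := gap P ℓ n'
  -- Such a `j` is below n', so it belongs to the first dataset, and it matches the state of the
  -- second dataset in the same block. That state may vary from block to block, as n need not divide
  -- n'; hence the pairing.
  obtain ⟨j, hj1, hj2, hj3⟩ : ∃ j, 1 ≤ j ∧ j ≤ n ∧ n ∣ r + j := by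
    have := Nat.mod_lt r hn
    refine ⟨n - r % n, by omega, by omega, ?_⟩
    have h2 := Nat.mod_add_div r n
    exact ⟨r / n + 1, by rw [mul_add, mul_one]; omega⟩
  have hskip : P.tmix ≤ skip P ℓ := le_max_right _ _
  refine measureReal_separates_le_of_paired (tmix := P.tmix) h1 hmix
    (a := fun i => barTime P ℓ t₀ (r + (2 * r + n') * i + j))
    (b := fun i => barTime P ℓ t₀ ((2 * r + n') * i)) ?_ ?_ ?_ ?_ ?_ ?_ hf
  · simp only [barTime]
    omega
  · intro i _
    simp only [barTime, add_mul]
    omega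
  · intro i _
    simp only [barTime, mul_add, add_mul, mul_one]
    have : j * ℓ ≤ n' * ℓ := Nat.mul_le_mul_right ℓ (by omega)
    have : 2 * r * ℓ = 2 * (r * ℓ) := mul_assoc _ _ _
    omega
  · intro i hi
    refine Finset.mem_image.mpr ⟨(i, j), ?_, rfl⟩
    simp only [Finset.mem_product, Finset.mem_range, Finset.mem_Icc]
    omega
  · intro i hi
    exact Finset.mem_image.mpr ⟨i, Finset.mem_range.mpr (by omega), rfl⟩
  · intro i _
    simp only [barTime, hlat]
    refine hper _ _ (by omega) (by omega) (Nat.ModEq.add_right _ ?_)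
    have h2 : (r + j) * ℓ ≡ 0 [MOD ℓ * n] :=
      Nat.modEq_zero_iff_dvd.mpr (by rw [mul_comm _ ℓ]; exact mul_dvd_mul_left ℓ hj3)
    have h3 := h2.add_right ((2 * r + n') * i * ℓ)
    rw [zero_add] at h3
    convert h3 using 1
    ring

/-- Old samples of the state at position `i` are unlikely to be separated from the new ones. The
first of the old samples, which may precede the mixing of the chain, is discarded. -/
theorem measureReal_separates_newTimes_le (h1 : 1 ≤ P.tmix)
    (hmix : mixingTime Te π (1 / 4) ≤ (P.tmix : ℕ∞)) (hL : 0 < ℓ * n) (hns : 1 ≤ nSamp P A)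
    {τ : Finset ℕ} {i : ℕ} {v : S}
    (hτ : Spaced P.tmix τ) (hcard : nSamp P A ≤ τ.card)
    (hgap : ∀ s ∈ τ, ∀ t ∈ newTimesAt P A ℓ t₀ n i (offB P A ℓ n), s + P.tmix ≤ t)
    (hv : ∀ t ∈ τ, lat t = v) (hv' : ∀ t ∈ newTimesAt P A ℓ t₀ n i (offB P A ℓ n), lat t = v)
    {f : X → Bool} (hf : Measurable f) :
    (trajLaw Q Te init lat).real {w | Separates f (sample (fun t => (w t).2) τ)
        (sample (fun t => (w t).2) (newTimes P A ℓ t₀ n i))} ≤ (9 / 16) ^ (nSamp P A - 1) := by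
  have hne : τ.Nonempty := Finset.card_pos.mp (by omega)
  set s₀ := τ.min' hne
  have hs₀τ : s₀ ∈ τ := Finset.min'_mem _ _
  obtain ⟨τ₀, hτ₀, hc₀⟩ := Finset.exists_subset_card_eq
    (show nSamp P A - 1 ≤ (τ.erase s₀).card by rw [Finset.card_erase_of_mem hs₀τ]; omega)
  -- Only the second half is sure to come a mixing time after all of `τ`; one of its samples is
  -- given up to balance the discarded old one.
  obtain ⟨τ₁, hτ₁, hc₁⟩ := Finset.exists_subset_card_eq
    (show nSamp P A - 1 ≤ (newTimesAt P A ℓ t₀ n i (offB P A ℓ n)).card by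
      rw [card_newTimesAt h1 hL]; omega)
  have hsub₀ : τ₀ ⊆ τ := hτ₀.trans (Finset.erase_subset _ _)
  have hgap' : ∀ s ∈ τ₀, ∀ t ∈ τ₁, s + P.tmix ≤ t := fun s hs t ht =>
    hgap s (hsub₀ hs) t (hτ₁ ht)
  have hsub : {w : ℕ → E × X | Separates f (sample (fun t => (w t).2) τ)
      (sample (fun t => (w t).2) (newTimes P A ℓ t₀ n i))} ⊆
      {w | Separates f (sample (fun t => (w t).2) τ₀) (sample (fun t => (w t).2) τ₁)} := by
    intro w hw
    refine Separates.mono hw hsub₀ (hτ₁.trans ?_)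
    rw [newTimes_eq_union]
    exact Finset.subset_union_right
  refine (measureReal_mono hsub).trans
    (measureReal_separates_le_of_same h1 hmix ?_ ?_ ?_ hf hc₀ hc₁ (v := v) ?_)
  · rw [Finset.disjoint_left]
    intro t ht ht'
    have := hgap' t ht t ht'
    omega
  · exact (hτ.mono hsub₀).union ((spaced_newTimesAt hL _ _ _).mono hτ₁) hgap'
  · intro t ht
    rcases Finset.mem_union.mp ht with ht | ht
    · have h2 := Finset.mem_erase.mp (hτ₀ ht)
      have h3 : s₀ < t := lt_of_le_of_ne (Finset.min'_le _ _ h2.2) (Ne.symm h2.1)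
      have h4 := hτ s₀ hs₀τ t h2.2 h3
      omega
    · have := hgap s₀ hs₀τ t (hτ₁ ht)
      omega
  · intro t ht
    rcases Finset.mem_union.mp ht with ht | ht
    · exact hv t (hsub₀ ht)
    · exact hv' t (hτ₁ ht)

end PeriodTest

/-! ### Reference samples fixed in advance -/

section Base

variable {X S A : Type*} [Fintype A]

open Classical in
/-- Times of samples by which the state `v` is recognized: the dataset of `v`, if `v` is already
known, and otherwise the first new dataset that consists of samples of `v`. -/
noncomputable def baseTimes (P : Params X) (m : PartialModel A) (σ : ℕ → S) (cyc : ℕ → S)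
    (ℓ t₀ n : ℕ) (v : S) : Finset ℕ :=
  if h : ∃ s ∈ m.states, σ s = v then m.data h.choose
  else if h : ∃ i, cyc i = v then newTimes P A ℓ t₀ n (Nat.find h) else ∅

variable {P : Params X} {m : PartialModel A} {σ cyc : ℕ → S} {ℓ t₀ n : ℕ}

theorem baseTimes_known (hinj : ∀ s ∈ m.states, ∀ s' ∈ m.states, σ s = σ s' → s = s') {s : ℕ}
    (hs : s ∈ m.states) : baseTimes P m σ cyc ℓ t₀ n (σ s) = m.data s := by
  have h : ∃ s' ∈ m.states, σ s' = σ s := ⟨s, hs, rfl⟩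
  rw [baseTimes, dif_pos h]
  exact congrArg _ (hinj _ h.choose_spec.1 _ hs h.choose_spec.2)

theorem baseTimes_unknown {i : ℕ} (hi : ∀ s ∈ m.states, σ s ≠ cyc i) :
    ∃ i' ≤ i, cyc i' = cyc i ∧ (∀ j < i', cyc j ≠ cyc i) ∧
      baseTimes P m σ cyc ℓ t₀ n (cyc i) = newTimes P A ℓ t₀ n i' := by
  classical
  have h : ¬ ∃ s ∈ m.states, σ s = cyc i := by
    push Not
    exact hi
  have h' : ∃ j, cyc j = cyc i := ⟨i, rfl⟩
  refine ⟨Nat.find h', Nat.find_min' h' rfl, Nat.find_spec h', fun j hj => Nat.find_min h' hj, ?_⟩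
  rw [baseTimes, dif_neg h, dif_pos h']

end Base

/-! ### Union bound -/

section Union

variable {Ω : Type*} [MeasurableSpace Ω] {μ : Measure Ω} [IsProbabilityMeasure μ]

theorem one_sub_le_measureReal_of_compl_subset {G B : Set Ω} {ε : ℝ} (h : Gᶜ ⊆ B)
    (hB : μ.real B ≤ ε) : 1 - ε ≤ μ.real G := by
  have h1 : (1 : ℝ) ≤ μ.real G + μ.real Gᶜ := by
    calc (1 : ℝ) = μ.real (G ∪ Gᶜ) := by rw [Set.union_compl_self, probReal_univ]
      _ ≤ _ := measureReal_union_le _ _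
  have h2 := measureReal_mono (μ := μ) h
  linarith

omit [IsProbabilityMeasure μ] in
theorem measureReal_exists_le {ι κ : Type*} {s : Finset ι} {t : Finset κ} {p : ι → κ → Ω → Prop}
    {ε : ℝ} (h : ∀ i ∈ s, ∀ j ∈ t, μ.real {w | p i j w} ≤ ε) :
    μ.real {w | ∃ i ∈ s, ∃ j ∈ t, p i j w} ≤ s.card * t.card * ε := by
  have hset : {w | ∃ i ∈ s, ∃ j ∈ t, p i j w} = ⋃ q ∈ s ×ˢ t, {w | p q.1 q.2 w} := by
    ext w
    simp only [Set.mem_ofPred_eq, Set.mem_iUnion, Finset.mem_product, Prod.exists, exists_prop]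
    constructor
    · rintro ⟨i, hi, j, hj, h⟩
      exact ⟨i, j, ⟨hi, hj⟩, h⟩
    · rintro ⟨i, j, ⟨hi, hj⟩, h⟩
      exact ⟨i, hi, j, hj, h⟩
  rw [hset]
  refine (measureReal_biUnion_finset_le _ _).trans ?_
  calc _ ≤ ∑ q ∈ s ×ˢ t, ε := Finset.sum_le_sum fun q hq =>
        h q.1 (Finset.mem_product.mp hq).1 q.2 (Finset.mem_product.mp hq).2
    _ = _ := by simp

end Union

/-! ### Splitting the failure probability -/

section Budget

variable {X A : Type*} [Fintype A] [Nonempty A] {P : Params X}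

/-- At most N - 1 candidates exceed the true period; together with the class size they cancel (N -
1)|F| in the sample size. -/
theorem period_budget (hN : 2 ≤ P.N) (hδ : 0 < P.δ) (hδ' : P.δ ≤ 1) (hF : 0 < P.F.card) {k : ℕ}
    (hk : k ≤ P.N - 1) :
    (k : ℝ) * P.F.card * (9 / 16 : ℝ) ^ nSampCyc P A ≤ P.δ / (4 * Fintype.card A * P.N) := by
  have hN' : (2 : ℝ) ≤ P.N := by exact_mod_cast hN
  have hA : (0 : ℝ) < Fintype.card A := by exact_mod_cast Fintype.card_pos
  have hF' : (0 : ℝ) < P.F.card := by exact_mod_cast hF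
  have hk' : (k : ℝ) ≤ P.N - 1 := by
    have : (k : ℝ) + 1 ≤ P.N := by exact_mod_cast (by omega : k + 1 ≤ P.N)
    linarith
  have hN1 : (0 : ℝ) < P.N - 1 := by linarith
  calc (k : ℝ) * P.F.card * (9 / 16 : ℝ) ^ nSampCyc P A
      ≤ (P.N - 1) * P.F.card *
        (P.δ / (4 * Fintype.card A * (P.N : ℝ) * ((P.N : ℝ) - 1) * P.F.card)) := by
        have := pow_nSampCyc_le (A := A) hN hδ hδ' hF
        gcongr
    _ = P.δ / (4 * Fintype.card A * P.N) := by
        field_simp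

/-- The discarded sample costs a factor 16/9 ≤ 2 ≤ N, absorbed by a spare power of N: the sample
size provides N⁴, the positions use N² and the target one more N. -/
theorem cycle_budget (hN : 2 ≤ P.N) (hδ : 0 < P.δ) (hδ' : P.δ ≤ 1) (hF : 0 < P.F.card) {L : ℕ}
    (hL : L ≤ (P.Dhat + 1) * P.N * P.N) :
    (L : ℝ) * P.F.card * (9 / 16 : ℝ) ^ (nSamp P A - 1) ≤ P.δ / (4 * Fintype.card A * P.N) := by
  have hN' : (2 : ℝ) ≤ P.N := by exact_mod_cast hN
  have hA : (0 : ℝ) < Fintype.card A := by exact_mod_cast Fintype.card_pos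
  have hF' : (0 : ℝ) < P.F.card := by exact_mod_cast hF
  have hL' : (L : ℝ) ≤ (P.Dhat + 1) * P.N * P.N := by exact_mod_cast hL
  have hD : (0 : ℝ) < (P.Dhat : ℝ) + 1 := by positivity
  have hpow : (9 / 16 : ℝ) ^ (nSamp P A - 1) = 16 / 9 * (9 / 16) ^ nSamp P A := by
    obtain ⟨c, hc⟩ := Nat.exists_eq_add_of_le (one_le_nSamp (A := A) hN hδ hδ' hF)
    rw [hc, Nat.add_sub_cancel_left, pow_add]
    ring
  rw [hpow]
  calc (L : ℝ) * P.F.card * (16 / 9 * (9 / 16 : ℝ) ^ nSamp P A)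
      ≤ (P.Dhat + 1) * P.N * P.N * P.F.card * (16 / 9 *
        (P.δ / (4 * Fintype.card A * (P.N : ℝ) ^ 4 * (P.Dhat + 1) * P.F.card))) := by
        have := pow_nSamp_le (A := A) hN hδ hδ' hF
        gcongr
    _ = 16 / 9 / P.N * (P.δ / (4 * Fintype.card A * P.N)) := by
        field_simp
    _ ≤ 1 * (P.δ / (4 * Fintype.card A * P.N)) := by
        have : 16 / 9 / (P.N : ℝ) ≤ 1 := by
          rw [div_le_one (by linarith)]
          linarith
        gcongr
    _ = _ := one_mul _

end Budget

end STEEL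

/-! ### Assembly of the estimates -/

theorem proposition1
    {X S A : Type*} [MeasurableSpace X] [Fintype S] [Fintype A] [DecidableEq A]
    -- the endogenous part of the Ex-BMDP, and the true encoder `φ`
    (T : S → A → S) (sInit : S) (φ : X → S)
    -- the parameters of the algorithm
    (P : Params X) (D : ℕ)
    (hN : 2 ≤ P.N) (hSN : Fintype.card S ≤ P.N)
    (hD : ReachableWithin T D) (hDhat : D ≤ P.Dhat)
    (htmix : 1 ≤ P.tmix) (hδ : 0 < P.δ) (hδ' : P.δ ≤ 1)
    (hF : ∀ f ∈ P.F, Measurable f)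
    (hreal : ∀ s : S, ∃ f ∈ P.F, ∀ x, f x = true ↔ φ x = s)
    (horacle : IsTrainingOracle P.F P.oracle) :
    -- latent cycles exist
    (∀ (ℓ : ℕ) [NeZero ℓ] (â : Fin ℓ → A), ℓ ≤ (D + 1) * P.N →
      ∃ (n : ℕ) (cyc : ℕ → S), n ≤ P.N ∧ IsLatentCycle T â n cyc) ∧
    -- CycleFind, called after the fixed actions `past`, with a fixed `â` and partial model `m`
    (∀ (past : List A) (ℓ : ℕ) [NeZero ℓ] (â : Fin ℓ → A) (m : PartialModel A) (σ : ℕ → S),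
      ℓ ≤ (D + 1) * P.N →
      Consistent T (latentSeq T sInit (actionSeq past â)) past.length (nSamp P A) P.tmix m σ →
      -- a fixed output, which does not depend on the noise
      ∃ (out : Output A) (σ' : ℕ → S) (n : ℕ) (cyc : ℕ → S),
        Consistent T (latentSeq T sInit (actionSeq past â)) (past.length + out.steps)
          (nSamp P A) P.tmix out.model σ' ∧
        (∀ s ∈ m.states, s ∈ out.model.states ∧ σ' s = σ s) ∧
        (∀ s ∈ m.states, ∀ a s', m.trans s a = some s' → out.model.trans s a = some s') ∧
        n ≤ P.N ∧ IsLatentCycle T â n cyc ∧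
        (∀ i < ℓ * n, ∃ s ∈ out.model.states, σ' s = cyc i) ∧
        (∀ i < ℓ * n, ∃ s ∈ out.model.states, ∃ s' ∈ out.model.states,
          σ' s = cyc i ∧ σ' s' = cyc ((i + 1) % (ℓ * n)) ∧
          out.model.trans s (â (Fin.ofNat ℓ i)) = some s') ∧
        out.curr ∈ out.model.states ∧
        (out.steps : ℤ) ≤
          max ((2 * (P.tmix : ℤ) + 3 * P.N * ℓ - 2) * nSampCyc P A - (P.N : ℤ) * ℓ)
            (2 * ((P.tmix : ℤ) + Fintype.card S * ℓ - 1) * nSamp P A + 1) +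
          max ((P.N : ℤ) * ℓ - ℓ - P.tmix) 0 + 1 ∧
        -- whatever the exogenous process, the run returns that output with high probability
        ∀ (E : Type*) [MeasurableSpace E] (Q : S → Kernel E X) [∀ s, IsMarkovKernel (Q s)]
          (Te : Kernel E E) [IsMarkovKernel Te] (init π : Measure E) [IsProbabilityMeasure init]
          [IsProbabilityMeasure π],
          (∀ s e, ∀ᵐ x ∂(Q s e), φ x = s) →
          Kernel.Invariant Te π →
          mixingTime Te π (1 / 4) ≤ (P.tmix : ℕ∞) →
          1 - P.δ / (2 * Fintype.card A * P.N) ≤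
            (trajLaw Q Te init (latentSeq T sInit (actionSeq past â))).real
              {w | cycleFind P â m past.length (fun t => (w t).2) = out ∧
                (∀ s ∈ out.model.states, ∀ t ∈ out.model.data s, φ (w t).2 = σ' s) ∧
                φ (w (past.length + out.steps)).2 = σ' out.curr}) := by
  classical
  have hcycle : ∀ (past : List A) (ℓ : ℕ) [NeZero ℓ] (â : Fin ℓ → A), _ := fun past ℓ _ â =>
    (followsLoop_latentSeq T sInit past â).exists_period
  refine ⟨fun ℓ _ â _ => ?_, fun past ℓ _ â m σ hℓN hm => ?_⟩
  · obtain ⟨n, hn, hnS, hper, -⟩ := hcycle [] ℓ â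
    exact ⟨n, _, hnS.trans hSN, (followsLoop_latentSeq T sInit [] â).isLatentCycle hn hper⟩
  have hℓ : 0 < ℓ := Nat.pos_of_ne_zero (NeZero.ne ℓ)
  have : Nonempty A := ⟨â ⟨0, hℓ⟩⟩
  obtain ⟨n, hn, hnS, hper, hdist⟩ := hcycle past ℓ â
  set lat := latentSeq T sInit (actionSeq past â)
  set h : ℕ → S := fun j => lat (past.length + j) with hdef
  set K := (Fintype.card S - n) * ℓ
  have hcyc := (followsLoop_latentSeq T sInit past â).isLatentCycle hn hper
  set cyc : ℕ → S := fun i => h (i + ℓ * n * K)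
  have hnN : n ≤ P.N := hnS.trans hSN
  have hL : 0 < ℓ * n := Nat.mul_pos hℓ hn
  have hKN : K ≤ (P.N - n) * ℓ := Nat.mul_le_mul_right ℓ (by omega)
  have hKoff : K ≤ offA P ℓ n := hKN.trans (le_max_left _ _)
  have hKskip : K ≤ skip P ℓ :=
    hKN.trans ((Nat.mul_le_mul_right ℓ (by omega)).trans (le_max_left _ _))
  have hKL : K ≤ ℓ * n * K := Nat.le_mul_of_pos_left K hL
  have hpos : ∀ i j, K ≤ j → j ≡ i [MOD ℓ * n] → h j = cyc i := fun i j hj hij =>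
    hper _ _ hj (by omega) (hij.trans (by simp [Nat.ModEq]))
  have hFpos : 0 < P.F.card := by
    obtain ⟨f, hf, -⟩ := hreal sInit
    exact Finset.card_pos.mpr ⟨f, hf⟩
  have hsc := one_le_nSampCyc (A := A) hN hδ hδ' hFpos
  have hns := one_le_nSamp (A := A) hN hδ hδ' hFpos
  set steps := max (cInit P A ℓ) (cFull P A ℓ n) with hsteps
  have hnewlat : ∀ i, ∀ t ∈ newTimes P A ℓ past.length n i, lat t = cyc i := by
    intro i t ht
    obtain ⟨-, j, rfl, hj, hij⟩ := mem_newTimes hL ht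
    exact hpos i j (hKoff.trans hj) hij
  set base := baseTimes P m σ cyc ℓ past.length n with hbasedef
  -- The output is fixed here, before any exogenous process is introduced; `hrun` later ties it to
  -- the observations.
  obtain ⟨m', lab, σ', hm', hlab, -, hext, hrun⟩ :=
    (hm.weaken (Nat.le_add_right past.length steps)).exists_identifyAll (φ := φ) horacle hreal
      (cyc := cyc) (k := ℓ * n) (fun i _ => hnewlat i)
      (fun i _ => nSamp_le_card_newTimes htmix hL past.length i)
      (fun i _ => spaced_newTimes hL past.length i)
      (fun i _ t ht => (mem_newTimes hL ht).1.trans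
        (Nat.add_le_add_left (le_max_right _ _) past.length))
      (base := base) (fun s hs => (baseTimes_known hm.inj hs).subset)
      (fun i _ hknown hfirst => by
        obtain ⟨i', hi', heq, -, hbase⟩ := baseTimes_unknown (P := P) (ℓ := ℓ)
          (t₀ := past.length) (n := n) hknown
        have : i' = i := by
          by_contra hne
          exact hfirst i' (by omega) heq
        rw [hbasedef, hbase, this])
  obtain ⟨hcons, hkeep, hadd⟩ := hm'.addTrans hcyc hlab le_rfl
  have hcurr := hlab _ (Nat.mod_lt steps hL)
  refine ⟨⟨{ m' with trans := addTrans â n lab m'.trans (ℓ * n) }, lab (steps % (ℓ * n)), steps⟩,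
    σ', n, cyc, hcons, fun s hs => ⟨(hext s hs).1, (hext s hs).2.1⟩, ?_, hnN, hcyc,
    fun i hi => ⟨_, hlab i hi⟩, ?_, hcurr.1, steps_le hN hℓ hn hnS hsc hns, ?_⟩
  · intro s hs a s' hss
    refine hkeep s (hext s hs).1 a s' ?_
    rw [(hext s hs).2.2]
    exact hss
  · intro i hi
    have h2 := hlab _ (Nat.mod_lt (i + 1) hL)
    exact ⟨_, (hlab i hi).1, _, h2.1, (hlab i hi).2, h2.2, hadd i hi⟩
  intro E _ Q _ Te _ init π _ _ hQ _ hmix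
  have hφ : ∀ s, MeasurableSet {x | φ x = s} := by
    intro s
    obtain ⟨f, hf, hfs⟩ := hreal s
    simp only [← hfs]
    exact hF f hf (measurableSet_singleton true)
  set μ := trajLaw Q Te init lat
  -- Three bad events: a mislabelled emission (null), a separable candidate above the period, and a
  -- position separable from its reference samples.
  set B₀ : Set (ℕ → E × X) := {w | ¬ ∀ t, φ (w t).2 = lat t} with hB₀
  set B₁ : Set (ℕ → E × X) := {w | ∃ n' ∈ Finset.Ioc n P.N, ∃ f ∈ P.F, Separates f
    (sample (fun t => (w t).2) (times₀ P A ℓ past.length n'))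
    (sample (fun t => (w t).2) (times₁ P A ℓ past.length n'))} with hB₁
  set B₂ : Set (ℕ → E × X) := {w | ∃ i ∈ Finset.range (ℓ * n), ∃ f ∈ P.F, Separates f
    (sample (fun t => (w t).2) (base (cyc i)))
    (sample (fun t => (w t).2) (newTimes P A ℓ past.length n i))} with hB₂
  have hb₀ : μ.real B₀ = 0 := by
    have := ae_label (Q := Q) (Te := Te) (init := init) (lat := lat) hφ hQ
    rw [ae_iff] at this
    rw [Measure.real, this, ENNReal.toReal_zero]
  have hb₁ : μ.real B₁ ≤ P.δ / (4 * Fintype.card A * P.N) := by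
    refine (measureReal_exists_le (ε := (9 / 16) ^ nSampCyc P A) fun n' hn' f hf => ?_).trans
      (period_budget (A := A) hN hδ hδ' hFpos (k := (Finset.Ioc n P.N).card)
        (by rw [Nat.card_Ioc]; omega))
    rw [Finset.mem_Ioc] at hn'
    exact measureReal_separates_period_le htmix hmix hN hsc hℓ hn hn'.1 hn'.2 (fun _ => rfl)
      hKskip hper (hF f hf)
  have hb₂ : μ.real B₂ ≤ P.δ / (4 * Fintype.card A * P.N) := by
    refine (measureReal_exists_le (ε := (9 / 16) ^ (nSamp P A - 1)) fun i hi f hf => ?_).trans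
      (cycle_budget (A := A) hN hδ hδ' hFpos (L := (Finset.range (ℓ * n)).card) ?_)
    · have hvB : ∀ t ∈ newTimesAt P A ℓ past.length n i (offB P A ℓ n), lat t = cyc i :=
        fun t ht => hnewlat i t (by
          rw [newTimes_eq_union]; exact Finset.mem_union_right _ ht)
      by_cases hknown : ∃ s ∈ m.states, σ s = cyc i
      · obtain ⟨s, hs, hsi⟩ := hknown
        rw [← hsi, hbasedef, baseTimes_known hm.inj hs]
        refine measureReal_separates_newTimes_le htmix hmix hL hns (hm.spaced s hs)
          (hm.card s hs) (fun t ht t' ht' => ?_) (v := cyc i)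
          (fun t ht => (hm.label s hs t ht).trans hsi) hvB (hF f hf)
        have h1 := hm.past s hs t ht
        have h2 := (mem_newTimesAt hL ht').1
        have h3 : P.tmix ≤ offA P ℓ n := le_max_right _ _
        unfold offB at h2
        omega
      · push Not at hknown
        obtain ⟨i', -, heq, -, hbase⟩ := baseTimes_unknown (P := P) (ℓ := ℓ)
          (t₀ := past.length) (n := n) hknown
        rw [hbasedef, hbase]
        -- For a new state, the first half at its first occurrence i' is compared with the second
        -- half at `i`; this also covers i' = i.
        have hsubA : newTimesAt P A ℓ past.length n i' (offA P ℓ n) ⊆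
            newTimes P A ℓ past.length n i' := by
          rw [newTimes_eq_union]
          exact Finset.subset_union_left
        exact (measureReal_mono fun w hw => Separates.mono hw hsubA subset_rfl).trans
          (measureReal_separates_newTimes_le htmix hmix hL hns (spaced_newTimesAt hL _ _ _)
            (card_newTimesAt htmix hL _ _ _).ge
            (fun s hs t ht => offA_half_add_le hL hs ht) (v := cyc i)
            (fun t ht => (hnewlat i' t (hsubA ht)).trans heq) hvB (hF f hf))
    · rw [Finset.card_range]
      exact Nat.mul_le_mul (hℓN.trans (Nat.mul_le_mul_right _ (by omega))) hnN
  refine one_sub_le_measureReal_of_compl_subset (B := B₀ ∪ B₁ ∪ B₂) ?_ ?_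
  · intro w hw
    by_contra hB
    simp only [Set.mem_union, not_or] at hB
    obtain ⟨⟨hw₀, hw₁⟩, hw₂⟩ := hB
    simp only [hB₀, Set.mem_ofPred_eq, not_not] at hw₀
    simp only [hB₁, Set.mem_ofPred_eq, not_exists, not_and, Finset.mem_Ioc] at hw₁
    simp only [hB₂, Set.mem_ofPred_eq, not_exists, not_and, Finset.mem_range] at hw₂
    refine hw ⟨?_, fun s hs t ht => (hw₀ t).trans (hcons.label s hs t ht), ?_⟩
    · have hperiod : findPeriod P A ℓ past.length (fun t => (w t).2) P.N = n :=
        findPeriod_eq hn hnN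
          (fun n' h1 h2 => test_eq_false horacle fun f hf => hw₁ n' ⟨h1, h2⟩ f hf)
          fun _ => test_period_eq_true horacle hreal hw₀ (fun _ => rfl) hKskip hper hdist
      have hident := hrun (fun t => (w t).2) hw₀ hw₂
      simp only [cycleFind, hperiod, hident, hsteps]
    · rw [hcurr.2, hw₀]
      -- At least n₀ ≥ K actions have been taken by then, so the final state lies on the cycle.
      refine hpos _ steps ?_ (Nat.mod_modEq _ _).symm
      exact hKoff.trans ((Nat.le_add_left _ _).trans (le_max_right _ _))
  · have h1 := measureReal_union_le (μ := μ) (B₀ ∪ B₁) B₂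
    have h2 := measureReal_union_le (μ := μ) B₀ B₁
    have h3 : P.δ / (2 * Fintype.card A * P.N) =
        P.δ / (4 * Fintype.card A * P.N) + P.δ / (4 * Fintype.card A * P.N) := by
      rw [← add_div, show (4 : ℝ) * Fintype.card A * P.N = 2 * (2 * Fintype.card A * P.N) by ring,
        ← two_mul, mul_div_mul_left _ _ (two_ne_zero)]
    linarith
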